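/- Let $Z$ be an irreducible random walk on $\mathbb{Z}^2$ whose increments have mean zero and finite variance, in discrete time or in continuous time (with some jump rate $\kappa>0$). Write $p_n(x)$, $n\in\{0,1,2,\dots\}$, respectively $p_t(x)$, $t\ge 0$, for the probability that the walk started at the origin is at $x$ at time $n$, respectively $t$, and let $\|\cdot\|$ be the Euclidean norm. Then there is a constant $0<C<\infty$, depending only on the walk, such that the following holds. In discrete time, for all $x,z_0\in\mathbb{Z}^2$ such that $p_n(x)\,p_n(x+z_0)>0$ for some $n$, $$\sum_{n=0}^\infty |p_n(x)-p_n(x+z_0)|\le C\|z_0\|\left(\frac{1}{1+\|x\|}+\frac{1}{1+\|x+z_0\|}\right).$$ In continuous time, for all $x,z_0\in\mathbb{Z}^2$, $$\int_0^\infty |p_t(x)-p_t(x+z_0)|\,dt\le C\|z_0\|\left(\frac{1}{1+\|x\|}+\frac{1}{1+\|x+z_0\|}\right).$$ -/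

import Mathlib

noncomputable section

namespace PlanarWalk

/-- The Euclidean norm of a lattice point (the default norm on `ℤ × ℤ` is the sup norm). -/
def enorm2 (x : ℤ × ℤ) : ℝ := Real.sqrt ((x.1 : ℝ) ^ 2 + (x.2 : ℝ) ^ 2)

/-- The law at time `n` of the discrete time random walk on `ℤ²` started at the origin with
i.i.d. increments of law `p`. -/
def stepLaw (p : PMF (ℤ × ℤ)) : ℕ → PMF (ℤ × ℤ)
  | 0 => PMF.pure 0
  | n + 1 => (stepLaw p n).bind fun y => p.map fun w => y + w

/-- The `n`-step transition probability `p_n(x)`: the probability of a displacement `x` in `n`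
steps of the discrete time walk. -/
def transProb (p : PMF (ℤ × ℤ)) (n : ℕ) (x : ℤ × ℤ) : ℝ := (stepLaw p n x).toReal

/-- The transition probability `p_t(x)` of the continuous time walk with jump rate `κ` and
increment law `p`: the number of jumps up to time `t` is Poisson with mean `κ t`, independent
of the increments. -/
def transProbCont (p : PMF (ℤ × ℤ)) (κ t : ℝ) (x : ℤ × ℤ) : ℝ :=
  ∑' n : ℕ, Real.exp (-(κ * t)) * (κ * t) ^ n / (n.factorial : ℝ) * transProb p n x

/-- Every lattice point is reached from the origin with positive probability. (For the continuous
time walk this is the same condition, since its jump chain visits the same points.) -/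
def IsIrreducible (p : PMF (ℤ × ℤ)) : Prop := ∀ x : ℤ × ℤ, ∃ n : ℕ, 0 < transProb p n x

/-- The increments have mean zero. -/
def HasZeroMean (p : PMF (ℤ × ℤ)) : Prop :=
  HasSum (fun x : ℤ × ℤ => (p x).toReal * (x.1 : ℝ)) 0 ∧
    HasSum (fun x : ℤ × ℤ => (p x).toReal * (x.2 : ℝ)) 0

/-- The increments have finite second moment. -/
def HasFiniteVariance (p : PMF (ℤ × ℤ)) : Prop :=
  Summable fun x : ℤ × ℤ => (p x).toReal * enorm2 x ^ 2

end PlanarWalk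

end

noncomputable section

namespace PlanarWalk

open MeasureTheory Filter Topology

/-! The heart is a bound at a single time: if `‖x‖ ≤ ‖x + z‖` and `n ≥ 1`, then `|p_n(x) - p_n(x+z)|
≤ K ‖z‖ / (√n ((1 + ‖x‖)² + n))` for admissible `z`. With `R = 1 + ‖x‖`, the sum over `n` behaves
like `∫ 2 ds / (R² + s²)`, which is of order `1/R`.

The bound comes from Fourier inversion. Let `φ` be the characteristic function of a step, `χ` the
character, and `g = √(1 - |φ|²)`. Since the walk may be periodic, `|φ|` may equal 1 away from the
origin, so `g`, rather than `|θ|`, measures the distance to such points. Four facts carry the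
argument: `|φ|ⁿ ≤ exp(-n g²/2)`; `∫ exp(-n g²/4) ≤ J/n`, where dimension two enters
(`exists_integral_exp_defect_le`); `|1 - χ(z)| ≤ C ‖z‖ g` for `z` in the subgroup `controlled`
(`exists_uniform_control`); and `|E[ℓ χ]| ≤ √V g` for a coordinate `ℓ` of the step, by mean zero and
Cauchy–Schwarz (`norm_fourierTr_coord_mul_inc_le`). They yield `p_n ≲ 1/n` and `ℓ² p_n ≲ 1`, with an
extra factor `‖z‖/√n` for differences along `z`. Two moments suffice because only the weights 1 and
`ℓ²` are used. Points charged at a common time differ by an element of `controlled`.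

For continuous time, the walk of rate `κ` has the law of its lazy version at rate `2κ`, for which
every `z` is controlled. Each Poisson weight integrates to `1/(2κ)`, so the discrete bound for the
lazy walk transfers. -/

theorem transProb_nonneg (p : PMF (ℤ × ℤ)) (n : ℕ) (x : ℤ × ℤ) : 0 ≤ transProb p n x :=
  ENNReal.toReal_nonneg

theorem transProb_zero (p : PMF (ℤ × ℤ)) (x : ℤ × ℤ) :
    transProb p 0 x = if x = 0 then 1 else 0 := by
  simp only [transProb, stepLaw, PMF.pure_apply]
  split_ifs <;> simp

theorem transProb_succ (p : PMF (ℤ × ℤ)) (n : ℕ) (x : ℤ × ℤ) :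
    transProb p (n + 1) x = ∑' y, transProb p n y * (p (x - y)).toReal := by
  have hmap : ∀ y : ℤ × ℤ, (p.map fun w => y + w) x = p (x - y) := by
    intro y
    rw [PMF.map_apply, tsum_eq_single (x - y)]
    · simp
    · intro b hb
      rw [if_neg]
      rintro rfl
      simp at hb
  simp only [transProb, stepLaw, PMF.bind_apply, hmap]
  rw [ENNReal.tsum_toReal_eq]
  · simp
  · intro y
    exact ENNReal.mul_ne_top (PMF.apply_ne_top _ _) (PMF.apply_ne_top _ _)

theorem hasSum_toReal (p : PMF (ℤ × ℤ)) : HasSum (fun w => (p w).toReal) 1 := by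
  have h : Summable fun w => (p w).toReal := ENNReal.summable_toReal p.tsum_coe_ne_top
  have h2 := ENNReal.tsum_toReal_eq (f := fun w => p w) fun w => p.apply_ne_top w
  rw [p.tsum_coe] at h2
  simp only [ENNReal.toReal_one] at h2
  rw [h2]; exact h.hasSum

theorem hasSum_transProb (p : PMF (ℤ × ℤ)) (n : ℕ) : HasSum (transProb p n) 1 :=
  hasSum_toReal (stepLaw p n)

/-! ### Convolution and the Fourier transform on `ℤ²`. -/

/-- The bijection `(x, y) ↦ (y, x - y)`. -/
def shearEquiv : (ℤ × ℤ) × (ℤ × ℤ) ≃ (ℤ × ℤ) × (ℤ × ℤ) where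
  toFun q := (q.2, q.1 - q.2)
  invFun q := (q.1 + q.2, q.1)
  left_inv q := by ext <;> simp
  right_inv q := by ext <;> simp

theorem summable_shear {a b : ℤ × ℤ → ℂ} (ha : Summable a) (hb : Summable b) :
    Summable fun q : (ℤ × ℤ) × (ℤ × ℤ) => a q.2 * b (q.1 - q.2) :=
  shearEquiv.summable_iff.2 (summable_mul_of_summable_norm ha.norm hb.norm)

theorem summable_conv_apply {a b : ℤ × ℤ → ℂ} (ha : Summable a) (hb : Summable b) (x : ℤ × ℤ) :
    Summable fun y => a y * b (x - y) :=
  (summable_shear ha hb).prod_factor x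

theorem hasSum_conv {a b : ℤ × ℤ → ℂ} (ha : Summable a) (hb : Summable b) :
    HasSum (fun x => ∑' y, a y * b (x - y)) ((∑' y, a y) * ∑' y, b y) := by
  have h := summable_shear ha hb
  have h1 : HasSum (fun q : (ℤ × ℤ) × (ℤ × ℤ) => a q.2 * b (q.1 - q.2))
      ((∑' y, a y) * ∑' y, b y) := by
    rw [tsum_mul_tsum_of_summable_norm ha.norm hb.norm]
    exact shearEquiv.hasSum_iff.2 (summable_mul_of_summable_norm ha.norm hb.norm).hasSum
  exact h1.prod_fiberwise fun x => (h.prod_factor x).hasSum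

/-- The character `w ↦ exp (2 π i θ · w)`. -/
def chr (θ : ℝ × ℝ) (w : ℤ × ℤ) : ℂ :=
  Complex.exp (((2 * Real.pi * (θ.1 * w.1 + θ.2 * w.2) : ℝ) : ℂ) * Complex.I)

theorem norm_chr (θ : ℝ × ℝ) (w : ℤ × ℤ) : ‖chr θ w‖ = 1 := Complex.norm_exp_ofReal_mul_I _

theorem chr_zero (θ : ℝ × ℝ) : chr θ 0 = 1 := by simp [chr]

theorem chr_add (θ : ℝ × ℝ) (v w : ℤ × ℤ) : chr θ (v + w) = chr θ v * chr θ w := by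
  simp only [chr, ← Complex.exp_add]
  congr 1
  push_cast [Prod.fst_add, Prod.snd_add]
  ring

theorem continuous_chr (w : ℤ × ℤ) : Continuous fun θ => chr θ w := by
  unfold chr; fun_prop

/-- The Fourier transform of a function on `ℤ²`. -/
def fourierTr (a : ℤ × ℤ → ℂ) (θ : ℝ × ℝ) : ℂ := ∑' w, a w * chr θ w

theorem summable_mul_chr {a : ℤ × ℤ → ℂ} (ha : Summable a) (θ : ℝ × ℝ) :
    Summable fun w => a w * chr θ w :=
  Summable.of_norm (by simpa [norm_chr] using ha.norm)

theorem norm_fourierTr_le {a : ℤ × ℤ → ℂ} (ha : Summable a) (θ : ℝ × ℝ) :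
    ‖fourierTr a θ‖ ≤ ∑' w, ‖a w‖ := by
  have := norm_tsum_le_tsum_norm (f := fun w => a w * chr θ w)
    (by simpa [norm_chr] using ha.norm)
  simpa [norm_chr, fourierTr] using this

theorem continuous_fourierTr {a : ℤ × ℤ → ℂ} (ha : Summable a) : Continuous (fourierTr a) :=
  continuous_tsum (fun w => (continuous_const.mul (continuous_chr w))) ha.norm
    fun w θ => by simp [norm_chr]

theorem fourierTr_add {a b : ℤ × ℤ → ℂ} (ha : Summable a) (hb : Summable b) (θ : ℝ × ℝ) :
    fourierTr (fun x => a x + b x) θ = fourierTr a θ + fourierTr b θ := by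
  simp only [fourierTr, add_mul]
  exact (summable_mul_chr ha θ).tsum_add (summable_mul_chr hb θ)

/-- Convolution of functions on `ℤ²`. -/
def conv (a b : ℤ × ℤ → ℂ) (x : ℤ × ℤ) : ℂ := ∑' y, a y * b (x - y)

theorem summable_conv {a b : ℤ × ℤ → ℂ} (ha : Summable a) (hb : Summable b) :
    Summable (conv a b) := (hasSum_conv ha hb).summable

theorem fourierTr_conv {a b : ℤ × ℤ → ℂ} (ha : Summable a) (hb : Summable b) (θ : ℝ × ℝ) :
    fourierTr (conv a b) θ = fourierTr a θ * fourierTr b θ := by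
  rw [fourierTr, fourierTr, fourierTr,
    ← (hasSum_conv (summable_mul_chr ha θ) (summable_mul_chr hb θ)).tsum_eq]
  congr 1; ext x
  rw [conv, ← tsum_mul_right]
  congr 1; ext y
  have : chr θ x = chr θ y * chr θ (x - y) := by rw [← chr_add]; congr 1; abel
  rw [this]; ring

/-- Multiplication by an additive `ℓ` is a derivation for convolution. This product rule replaces
differentiation of the characteristic function. -/
theorem mul_conv {a b : ℤ × ℤ → ℂ} {ℓ : ℤ × ℤ →+ ℤ} (ha : Summable a) (hb : Summable b)
    (ha1 : Summable fun x => (ℓ x : ℂ) * a x) (hb1 : Summable fun x => (ℓ x : ℂ) * b x)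
    (x : ℤ × ℤ) :
    (ℓ x : ℂ) * conv a b x
      = conv (fun x => (ℓ x : ℂ) * a x) b x + conv a (fun x => (ℓ x : ℂ) * b x) x := by
  rw [conv, conv, conv, ← tsum_mul_left,
    ← (summable_conv_apply ha1 hb x).tsum_add (summable_conv_apply ha hb1 x)]
  congr 1; ext y
  have : (ℓ x : ℂ) = ℓ y + ℓ (x - y) := by rw [map_sub]; push_cast; ring
  rw [this]; ring

/-- The law of the walk at time `n`, with complex values. -/
def law (p : PMF (ℤ × ℤ)) (n : ℕ) (x : ℤ × ℤ) : ℂ := (transProb p n x : ℂ)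

/-- The increment law, with complex values. -/
def inc (p : PMF (ℤ × ℤ)) (w : ℤ × ℤ) : ℂ := ((p w).toReal : ℂ)

theorem summable_law (p : PMF (ℤ × ℤ)) (n : ℕ) : Summable (law p n) :=
  Complex.summable_ofReal.2 (hasSum_transProb p n).summable

theorem hasSum_inc (p : PMF (ℤ × ℤ)) : HasSum (inc p) 1 := by
  have h : HasSum (fun w => ((p w).toReal : ℂ)) ((1 : ℝ) : ℂ) :=
    Complex.hasSum_ofReal.2 (hasSum_toReal p)
  rwa [Complex.ofReal_one] at h

theorem summable_inc (p : PMF (ℤ × ℤ)) : Summable (inc p) := (hasSum_inc p).summable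

theorem law_succ (p : PMF (ℤ × ℤ)) (n : ℕ) : law p (n + 1) = conv (law p n) (inc p) := by
  ext x
  simp only [law, conv, inc, transProb_succ, Complex.ofReal_tsum, Complex.ofReal_mul]

theorem law_zero (p : PMF (ℤ × ℤ)) (x : ℤ × ℤ) : law p 0 x = if x = 0 then 1 else 0 := by
  simp only [law, transProb_zero]; split_ifs <;> simp

theorem fourierTr_law (p : PMF (ℤ × ℤ)) (n : ℕ) (θ : ℝ × ℝ) :
    fourierTr (law p n) θ = fourierTr (inc p) θ ^ n := by
  induction n with
  | zero =>
    rw [fourierTr, tsum_eq_single 0]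
    · simp [law_zero, chr_zero]
    · intro b hb; simp [law_zero, hb]
  | succ n ih => rw [law_succ, fourierTr_conv (summable_law p n) (summable_inc p), ih, pow_succ]

/-! ### Recursions in time for the transforms of `ℓ p_n` and `ℓ² p_n`. -/

section Moments

variable {p : PMF (ℤ × ℤ)} {ℓ : ℤ × ℤ →+ ℤ}

theorem summable_coord_mul_inc (h2 : Summable fun x => (ℓ x : ℂ) ^ 2 * inc p x) :
    Summable fun x => (ℓ x : ℂ) * inc p x := by
  refine Summable.of_norm_bounded (g := fun x => ‖inc p x‖ + ‖(ℓ x : ℂ) ^ 2 * inc p x‖)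
    ((summable_inc p).norm.add h2.norm) fun x => ?_
  simp only [norm_mul, norm_pow]
  nlinarith [norm_nonneg (inc p x), mul_nonneg (norm_nonneg (inc p x))
    (sq_nonneg (‖(ℓ x : ℂ)‖ - 1))]

theorem summable_coord_moments (h2 : Summable fun x => (ℓ x : ℂ) ^ 2 * inc p x) (n : ℕ) :
    (Summable fun x => (ℓ x : ℂ) * law p n x) ∧
      Summable fun x => (ℓ x : ℂ) ^ 2 * law p n x := by
  have h1 := summable_coord_mul_inc h2
  have h0 := summable_inc p
  induction n with
  | zero =>
    constructor <;>
    · refine summable_of_ne_finset_zero (s := {0}) fun x hx => ?_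
      rw [Finset.mem_singleton] at hx
      simp [law_zero, hx]
  | succ n ih =>
    have e1 : (fun x => (ℓ x : ℂ) * law p (n + 1) x) = fun x =>
        conv (fun x => (ℓ x : ℂ) * law p n x) (inc p) x
          + conv (law p n) (fun x => (ℓ x : ℂ) * inc p x) x := by
      ext x; rw [law_succ, mul_conv (summable_law p n) h0 ih.1 h1]
    have i2 : Summable fun x => (ℓ x : ℂ) * ((ℓ x : ℂ) * law p n x) := by
      simpa only [sq, mul_assoc] using ih.2
    have j2 : Summable fun x => (ℓ x : ℂ) * ((ℓ x : ℂ) * inc p x) := by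
      simpa only [sq, mul_assoc] using h2
    refine ⟨e1 ▸ (summable_conv ih.1 h0).add (summable_conv (summable_law p n) h1), ?_⟩
    have e2 : (fun x => (ℓ x : ℂ) ^ 2 * law p (n + 1) x) = fun x =>
        (conv (fun x => (ℓ x : ℂ) * ((ℓ x : ℂ) * law p n x)) (inc p) x
          + conv (fun x => (ℓ x : ℂ) * law p n x) (fun x => (ℓ x : ℂ) * inc p x) x)
        + (conv (fun x => (ℓ x : ℂ) * law p n x) (fun x => (ℓ x : ℂ) * inc p x) x
          + conv (law p n) (fun x => (ℓ x : ℂ) * ((ℓ x : ℂ) * inc p x)) x) := by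
      ext x
      rw [sq, mul_assoc, congrFun e1 x, mul_add, mul_conv ih.1 h0 i2 h1,
        mul_conv (summable_law p n) h1 ih.1 j2]
    rw [e2]
    exact ((summable_conv i2 h0).add (summable_conv ih.1 h1)).add
      ((summable_conv ih.1 h1).add (summable_conv (summable_law p n) j2))

theorem fourierTr_coord_mul_law_succ (h2 : Summable fun x => (ℓ x : ℂ) ^ 2 * inc p x) (n : ℕ)
    (θ : ℝ × ℝ) :
    fourierTr (fun x => (ℓ x : ℂ) * law p (n + 1) x) θ
      = fourierTr (fun x => (ℓ x : ℂ) * law p n x) θ * fourierTr (inc p) θ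
        + fourierTr (inc p) θ ^ n * fourierTr (fun x => (ℓ x : ℂ) * inc p x) θ := by
  have h1 := summable_coord_mul_inc h2
  have h0 := summable_inc p
  have ih := summable_coord_moments h2 n
  have e1 : (fun x => (ℓ x : ℂ) * law p (n + 1) x) = fun x =>
      conv (fun x => (ℓ x : ℂ) * law p n x) (inc p) x
        + conv (law p n) (fun x => (ℓ x : ℂ) * inc p x) x := by
    ext x; rw [law_succ, mul_conv (summable_law p n) h0 ih.1 h1]
  rw [e1, fourierTr_add (summable_conv ih.1 h0) (summable_conv (summable_law p n) h1),
    fourierTr_conv ih.1 h0, fourierTr_conv (summable_law p n) h1, fourierTr_law]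

theorem fourierTr_coord_sq_mul_law_succ (h2 : Summable fun x => (ℓ x : ℂ) ^ 2 * inc p x) (n : ℕ)
    (θ : ℝ × ℝ) :
    fourierTr (fun x => (ℓ x : ℂ) ^ 2 * law p (n + 1) x) θ
      = fourierTr (fun x => (ℓ x : ℂ) ^ 2 * law p n x) θ * fourierTr (inc p) θ
        + 2 * (fourierTr (fun x => (ℓ x : ℂ) * law p n x) θ
          * fourierTr (fun x => (ℓ x : ℂ) * inc p x) θ)
        + fourierTr (inc p) θ ^ n * fourierTr (fun x => (ℓ x : ℂ) ^ 2 * inc p x) θ := by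
  have h1 := summable_coord_mul_inc h2
  have h0 := summable_inc p
  have ih := summable_coord_moments h2 n
  have i2 : Summable fun x => (ℓ x : ℂ) * ((ℓ x : ℂ) * law p n x) := by
    simpa only [sq, mul_assoc] using ih.2
  have j2 : Summable fun x => (ℓ x : ℂ) * ((ℓ x : ℂ) * inc p x) := by
    simpa only [sq, mul_assoc] using h2
  have e2 : (fun x => (ℓ x : ℂ) ^ 2 * law p (n + 1) x) = fun x =>
      (conv (fun x => (ℓ x : ℂ) * ((ℓ x : ℂ) * law p n x)) (inc p) x
        + conv (fun x => (ℓ x : ℂ) * law p n x) (fun x => (ℓ x : ℂ) * inc p x) x)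
      + (conv (fun x => (ℓ x : ℂ) * law p n x) (fun x => (ℓ x : ℂ) * inc p x) x
        + conv (law p n) (fun x => (ℓ x : ℂ) * ((ℓ x : ℂ) * inc p x)) x) := by
    ext x
    rw [sq, mul_assoc, law_succ, mul_conv (summable_law p n) h0 ih.1 h1, mul_add,
      mul_conv ih.1 h0 i2 h1, mul_conv (summable_law p n) h1 ih.1 j2]
  rw [e2, fourierTr_add ((summable_conv i2 h0).add (summable_conv ih.1 h1))
      ((summable_conv ih.1 h1).add (summable_conv (summable_law p n) j2)),
    fourierTr_add (summable_conv i2 h0) (summable_conv ih.1 h1),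
    fourierTr_add (summable_conv ih.1 h1) (summable_conv (summable_law p n) j2),
    fourierTr_conv i2 h0, fourierTr_conv ih.1 h1, fourierTr_conv (summable_law p n) j2,
    fourierTr_law]
  simp only [sq, mul_assoc]
  ring

end Moments

/-! ### The defect of the characteristic function, and moment bounds in terms of it. -/

/-- The defect `1 - |φ(θ)|²` of the characteristic function. -/
def defectSq (p : PMF (ℤ × ℤ)) (θ : ℝ × ℝ) : ℝ := 1 - ‖fourierTr (inc p) θ‖ ^ 2

/-- The variance of the unimodular variable `χ(w)`, whose mean is `φ`, equals `1 - |φ|²`. Thus a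
small defect forces `χ` to be nearly constant on the support of the step. -/
theorem hasSum_normSq_chr_sub (p : PMF (ℤ × ℤ)) (θ : ℝ × ℝ) :
    HasSum (fun w => (p w).toReal * ‖chr θ w - fourierTr (inc p) θ‖ ^ 2) (defectSq p θ) := by
  set φ := fourierTr (inc p) θ with hφ
  have h0 : HasSum (fun w => inc p w * chr θ w) φ :=
    (summable_mul_chr (summable_inc p) θ).hasSum
  have hre := Complex.hasSum_re (h0.mul_right (starRingEnd ℂ φ))
  have h1 := ((hasSum_toReal p).mul_right (1 + ‖φ‖ ^ 2)).sub (hre.mul_left 2)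
  have hval : defectSq p θ = 1 * (1 + ‖φ‖ ^ 2) - 2 * (φ * (starRingEnd ℂ) φ).re := by
    rw [defectSq, Complex.mul_conj, Complex.normSq_eq_norm_sq, Complex.ofReal_re]; ring
  have hfun : (fun w => (p w).toReal * ‖chr θ w - φ‖ ^ 2) = fun w =>
      (p w).toReal * (1 + ‖φ‖ ^ 2) - 2 * (inc p w * chr θ w * (starRingEnd ℂ) φ).re := by
    ext w
    have hc := norm_chr θ w
    rw [← Complex.normSq_eq_norm_sq, Complex.normSq_sub, Complex.normSq_eq_norm_sq,
      Complex.normSq_eq_norm_sq, hc, inc, mul_assoc, Complex.re_ofReal_mul]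
    ring
  rw [hval, hfun]
  exact h1

theorem defectSq_nonneg (p : PMF (ℤ × ℤ)) (θ : ℝ × ℝ) : 0 ≤ defectSq p θ :=
  (hasSum_normSq_chr_sub p θ).nonneg fun _ => by positivity

theorem defectSq_le_one (p : PMF (ℤ × ℤ)) (θ : ℝ × ℝ) : defectSq p θ ≤ 1 := by
  rw [defectSq]; linarith [sq_nonneg ‖fourierTr (inc p) θ‖]

/-- The square root of the defect of the characteristic function. -/
def defect (p : PMF (ℤ × ℤ)) (θ : ℝ × ℝ) : ℝ := Real.sqrt (defectSq p θ)

theorem defect_nonneg (p : PMF (ℤ × ℤ)) (θ : ℝ × ℝ) : 0 ≤ defect p θ := Real.sqrt_nonneg _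

theorem sq_defect (p : PMF (ℤ × ℤ)) (θ : ℝ × ℝ) : defect p θ ^ 2 = defectSq p θ :=
  Real.sq_sqrt (defectSq_nonneg p θ)

theorem continuous_defect (p : PMF (ℤ × ℤ)) : Continuous (defect p) := by
  have := continuous_fourierTr (summable_inc p)
  unfold defect defectSq
  fun_prop

theorem norm_fourierTr_inc_le_one (p : PMF (ℤ × ℤ)) (θ : ℝ × ℝ) : ‖fourierTr (inc p) θ‖ ≤ 1 := by
  have := defectSq_nonneg p θ
  rw [defectSq] at this
  nlinarith [norm_nonneg (fourierTr (inc p) θ)]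

theorem norm_fourierTr_inc_le_exp (p : PMF (ℤ × ℤ)) (θ : ℝ × ℝ) :
    ‖fourierTr (inc p) θ‖ ≤ Real.exp (-(defect p θ ^ 2 / 2)) := by
  refine le_of_sq_le_sq ?_ (Real.exp_pos _).le
  rw [← Real.exp_nat_mul]
  have := Real.add_one_le_exp (-(defect p θ ^ 2))
  rw [show ((2 : ℕ) : ℝ) * -(defect p θ ^ 2 / 2) = -(defect p θ ^ 2) by push_cast; ring]
  rw [sq_defect, defectSq] at *
  linarith

/-- A single term of the variance sum is at most the whole sum. -/
theorem norm_chr_sub_le (p : PMF (ℤ × ℤ)) (θ : ℝ × ℝ) {w : ℤ × ℤ} (hw : 0 < (p w).toReal) :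
    ‖chr θ w - fourierTr (inc p) θ‖ ≤ 1 / Real.sqrt (p w).toReal * defect p θ := by
  have h : (p w).toReal * ‖chr θ w - fourierTr (inc p) θ‖ ^ 2 ≤ defectSq p θ :=
    le_hasSum (hasSum_normSq_chr_sub p θ) w fun _ _ => by positivity
  have hs := Real.sqrt_pos.2 hw
  rw [one_div, inv_mul_eq_div, le_div_iff₀ hs]
  refine le_of_sq_le_sq ?_ (defect_nonneg p θ)
  rw [mul_pow, Real.sq_sqrt hw.le, sq_defect]
  linarith

theorem norm_fourierTr_coord_mul_inc_le {p : PMF (ℤ × ℤ)} {ℓ : ℤ × ℤ →+ ℤ} {V : ℝ}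
    (h1 : HasSum (fun x => (ℓ x : ℝ) * (p x).toReal) 0)
    (h2 : HasSum (fun x => (ℓ x : ℝ) ^ 2 * (p x).toReal) V) (θ : ℝ × ℝ) :
    ‖fourierTr (fun x => (ℓ x : ℂ) * inc p x) θ‖ ≤ Real.sqrt V * defect p θ := by
  set φ := fourierTr (inc p) θ with hφ
  have hV : 0 ≤ V := h2.nonneg fun _ => by positivity
  have hd := hasSum_normSq_chr_sub p θ
  have hB : Summable fun x => |(ℓ x : ℝ)| * (p x).toReal * ‖chr θ x - φ‖ := by
    refine Summable.of_nonneg_of_le (fun x => by positivity) (fun x => ?_)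
      (h2.summable.add hd.summable)
    have := ENNReal.toReal_nonneg (a := p x)
    rw [← sq_abs (ℓ x : ℝ)]
    nlinarith [mul_nonneg this (sq_nonneg (|(ℓ x : ℝ)| - ‖chr θ x - φ‖)),
      mul_nonneg this (mul_nonneg (abs_nonneg (ℓ x : ℝ)) (norm_nonneg (chr θ x - φ)))]
  -- Cauchy–Schwarz for the infinite sum: this quadratic in `t` is the sum of `p(x) (|ℓ(x)| t +
  -- |χ(x) - φ|)²`, so its discriminant is nonpositive.
  have hkey : ∀ t : ℝ, 0 ≤ V * (t * t)
      + (2 * ∑' x, |(ℓ x : ℝ)| * (p x).toReal * ‖chr θ x - φ‖) * t + defectSq p θ := by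
    intro t
    have hs := ((h2.mul_right (t * t)).add ((hB.hasSum.mul_left 2).mul_right t)).add hd
    refine hs.nonneg fun x => ?_
    have := ENNReal.toReal_nonneg (a := p x)
    rw [← sq_abs (ℓ x : ℝ)]
    nlinarith [mul_nonneg this (sq_nonneg (|(ℓ x : ℝ)| * t + ‖chr θ x - φ‖))]
  have hdisc := discrim_le_zero hkey
  -- Mean zero allows the constant `φ` to be subtracted from `χ` without changing the sum.
  have hsum : HasSum (fun x => (ℓ x : ℂ) * inc p x * (chr θ x - φ))
      (fourierTr (fun x => (ℓ x : ℂ) * inc p x) θ) := by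
    have c1 : HasSum (fun x => (ℓ x : ℂ) * inc p x) 0 := by
      have := Complex.hasSum_ofReal.2 h1
      simpa [inc] using this
    have := (summable_mul_chr c1.summable θ).hasSum.sub (c1.mul_right φ)
    simpa [mul_sub, fourierTr] using this
  have hle : ‖fourierTr (fun x => (ℓ x : ℂ) * inc p x) θ‖
      ≤ ∑' x, |(ℓ x : ℝ)| * (p x).toReal * ‖chr θ x - φ‖ := by
    rw [← hsum.tsum_eq]
    have hn : ∀ x, ‖(ℓ x : ℂ) * inc p x * (chr θ x - φ)‖
        = |(ℓ x : ℝ)| * (p x).toReal * ‖chr θ x - φ‖ := by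
      intro x
      rw [norm_mul, norm_mul, inc, Complex.norm_real, Real.norm_of_nonneg ENNReal.toReal_nonneg,
        ← Complex.ofReal_intCast, Complex.norm_real, Real.norm_eq_abs]
    refine (norm_tsum_le_tsum_norm ?_).trans_eq (tsum_congr hn)
    simpa only [hn] using hB
  refine hle.trans (le_of_sq_le_sq ?_ (mul_nonneg (Real.sqrt_nonneg _) (defect_nonneg p θ)))
  rw [mul_pow, Real.sq_sqrt hV, sq_defect]
  rw [discrim] at hdisc
  linarith

section MomentBounds

variable {p : PMF (ℤ × ℤ)} {ℓ : ℤ × ℤ →+ ℤ} {V : ℝ}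

theorem summable_coord_sq_mul_inc (h2 : HasSum (fun x => (ℓ x : ℝ) ^ 2 * (p x).toReal) V) :
    Summable fun x => (ℓ x : ℂ) ^ 2 * inc p x := by
  have := Complex.summable_ofReal.2 h2.summable
  simpa [inc] using this

theorem norm_fourierTr_coord_sq_mul_inc_le
    (h2 : HasSum (fun x => (ℓ x : ℝ) ^ 2 * (p x).toReal) V) (θ : ℝ × ℝ) :
    ‖fourierTr (fun x => (ℓ x : ℂ) ^ 2 * inc p x) θ‖ ≤ V := by
  refine (norm_fourierTr_le (summable_coord_sq_mul_inc h2) θ).trans_eq ?_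
  rw [← h2.tsum_eq]
  refine tsum_congr fun x => ?_
  rw [norm_mul, norm_pow, inc, Complex.norm_real, Real.norm_of_nonneg ENNReal.toReal_nonneg,
    ← Complex.ofReal_intCast, Complex.norm_real, Real.norm_eq_abs, sq_abs]

/-- By the product rule this transform is `n φⁿ⁻¹` times that of `ℓ p`. As `φ` may vanish, a
positive majorant `ρ` of `|φ|` takes its place, so that division is allowed. -/
theorem norm_fourierTr_coord_mul_law_le
    (h1 : HasSum (fun x => (ℓ x : ℝ) * (p x).toReal) 0)
    (h2 : HasSum (fun x => (ℓ x : ℝ) ^ 2 * (p x).toReal) V) (θ : ℝ × ℝ) {ρ : ℝ} (hρ : 0 < ρ)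
    (hφ : ‖fourierTr (inc p) θ‖ ≤ ρ) (n : ℕ) :
    ‖fourierTr (fun x => (ℓ x : ℂ) * law p n x) θ‖
      ≤ n * (Real.sqrt V * defect p θ) / ρ * ρ ^ n := by
  have hd := norm_fourierTr_coord_mul_inc_le h1 h2 θ
  set v := Real.sqrt V * defect p θ
  induction n with
  | zero =>
    have hzero : (fun x => (ℓ x : ℂ) * law p 0 x) = fun _ => 0 := by
      ext x
      by_cases hx : x = 0 <;> simp [law_zero, hx]
    rw [hzero]
    simp [fourierTr]
  | succ n ih =>
    rw [fourierTr_coord_mul_law_succ (summable_coord_sq_mul_inc h2)]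
    refine (norm_add_le _ _).trans ?_
    rw [norm_mul, norm_mul, norm_pow]
    have hv : 0 ≤ v := (norm_nonneg _).trans hd
    have a1 := mul_le_mul ih hφ (norm_nonneg _) (by positivity)
    have a2 := mul_le_mul (pow_le_pow_left₀ (norm_nonneg _) hφ n) hd (norm_nonneg _)
      (by positivity)
    refine (add_le_add a1 a2).trans_eq ?_
    push_cast
    field_simp
    ring

theorem norm_fourierTr_coord_sq_mul_law_le
    (h1 : HasSum (fun x => (ℓ x : ℝ) * (p x).toReal) 0)
    (h2 : HasSum (fun x => (ℓ x : ℝ) ^ 2 * (p x).toReal) V) (θ : ℝ × ℝ) {ρ : ℝ} (hρ : 0 < ρ)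
    (hφ : ‖fourierTr (inc p) θ‖ ≤ ρ) (n : ℕ) :
    ‖fourierTr (fun x => (ℓ x : ℂ) ^ 2 * law p n x) θ‖
      ≤ (n * V / ρ + n ^ 2 * (Real.sqrt V * defect p θ) ^ 2 / ρ ^ 2) * ρ ^ n := by
  have hd := norm_fourierTr_coord_mul_inc_le h1 h2 θ
  have hV := norm_fourierTr_coord_sq_mul_inc_le h2 θ
  have hV0 : 0 ≤ V := (norm_nonneg _).trans hV
  have hb := norm_fourierTr_coord_mul_law_le h1 h2 θ hρ hφ
  set v := Real.sqrt V * defect p θ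
  have hv : 0 ≤ v := (norm_nonneg _).trans hd
  induction n with
  | zero =>
    have hzero : (fun x => (ℓ x : ℂ) ^ 2 * law p 0 x) = fun _ => 0 := by
      ext x
      by_cases hx : x = 0 <;> simp [law_zero, hx]
    rw [hzero]
    simp [fourierTr]
  | succ n ih =>
    rw [fourierTr_coord_sq_mul_law_succ (summable_coord_sq_mul_inc h2)]
    refine (norm_add₃_le).trans ?_
    rw [norm_mul, norm_mul, norm_mul, norm_mul, norm_pow, Complex.norm_ofNat]
    have a1 := mul_le_mul ih hφ (norm_nonneg _) (by positivity)
    have a2 := mul_le_mul (hb n) hd (norm_nonneg _) (by positivity)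
    have a3 := mul_le_mul (pow_le_pow_left₀ (norm_nonneg _) hφ n) hV (norm_nonneg _)
      (by positivity)
    -- The exact coefficient is `n (n - 1)`. Using `n²` instead leaves this surplus at each
    -- induction step.
    have a4 : 0 ≤ v ^ 2 / ρ ^ 2 * ρ ^ (n + 1) := by positivity
    refine (add_le_add (add_le_add a1 (mul_le_mul_of_nonneg_left a2 zero_le_two)) a3).trans ?_
    have key : ((n + 1 : ℕ) * V / ρ + (n + 1 : ℕ) ^ 2 * v ^ 2 / ρ ^ 2) * ρ ^ (n + 1)
      = (n * V / ρ + n ^ 2 * v ^ 2 / ρ ^ 2) * ρ ^ n * ρ + 2 * (n * v / ρ * ρ ^ n * v)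
        + ρ ^ n * V + v ^ 2 / ρ ^ 2 * ρ ^ (n + 1) := by
      push_cast
      field_simp
      ring
    linarith

/-- Take `ρ = exp(-g²/2)`. Since `g ≤ 1`, the factors `1/ρ` and `1/ρ²` are at most `e`, hence the
constant 3. -/
theorem norm_fourierTr_coord_sq_mul_law_le_exp
    (h1 : HasSum (fun x => (ℓ x : ℝ) * (p x).toReal) 0)
    (h2 : HasSum (fun x => (ℓ x : ℝ) ^ 2 * (p x).toReal) V) (θ : ℝ × ℝ) (n : ℕ) :
    ‖fourierTr (fun x => (ℓ x : ℂ) ^ 2 * law p n x) θ‖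
      ≤ 3 * V * (n + n ^ 2 * defect p θ ^ 2) * Real.exp (-(n * defect p θ ^ 2 / 2)) := by
  have hV0 : 0 ≤ V := h2.nonneg fun _ => by positivity
  have h := norm_fourierTr_coord_sq_mul_law_le h1 h2 θ (Real.exp_pos _)
    (norm_fourierTr_inc_le_exp p θ) n
  have hg : defect p θ ^ 2 ≤ 1 := (sq_defect p θ).trans_le (defectSq_le_one p θ)
  rw [mul_pow, Real.sq_sqrt hV0, div_eq_mul_inv (n * V : ℝ),
    div_eq_mul_inv (n ^ 2 * (V * defect p θ ^ 2) : ℝ), ← Real.exp_nat_mul,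
    ← Real.exp_nat_mul, ← Real.exp_neg, ← Real.exp_neg] at h
  have he : Real.exp 1 ≤ 3 := Real.exp_one_lt_three.le
  have e1 : Real.exp (-(-(defect p θ ^ 2 / 2))) ≤ 3 :=
    (Real.exp_le_exp.2 (by linarith)).trans he
  have e2 : Real.exp (-((2 : ℕ) * -(defect p θ ^ 2 / 2))) ≤ 3 :=
    (Real.exp_le_exp.2 (by push_cast; linarith)).trans he
  rw [show -(n * defect p θ ^ 2 / 2) = n * -(defect p θ ^ 2 / 2) by ring]
  refine h.trans (mul_le_mul_of_nonneg_right ?_ (Real.exp_pos _).le)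
  have b1 := mul_le_mul_of_nonneg_left e1 (show 0 ≤ n * V by positivity)
  have b2 := mul_le_mul_of_nonneg_left e2 (show 0 ≤ n ^ 2 * (V * defect p θ ^ 2) by positivity)
  linarith

end MomentBounds

theorem norm_fourierTr_law_le_exp (p : PMF (ℤ × ℤ)) (n : ℕ) (θ : ℝ × ℝ) :
    ‖fourierTr (law p n) θ‖ ≤ Real.exp (-(n * defect p θ ^ 2 / 2)) := by
  rw [fourierTr_law, norm_pow,
    show -(n * defect p θ ^ 2 / 2) = n * -(defect p θ ^ 2 / 2) by ring, Real.exp_nat_mul]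
  exact pow_le_pow_left₀ (norm_nonneg _) (norm_fourierTr_inc_le_exp p θ) n

/-! ### Displacements along which characters are controlled by the defect. -/

section Control

variable {p : PMF (ℤ × ℤ)}

theorem norm_mul_sub_mul_le {a b c d : ℂ} (ha : ‖a‖ ≤ 1) (hd : ‖d‖ ≤ 1) :
    ‖a * b - c * d‖ ≤ ‖a - c‖ + ‖b - d‖ := by
  have : a * b - c * d = a * (b - d) + (a - c) * d := by ring
  rw [this]
  refine (norm_add_le _ _).trans ?_
  rw [norm_mul, norm_mul]
  nlinarith [norm_nonneg (b - d), norm_nonneg (a - c)]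

theorem norm_pow_sub_pow_le {a b : ℂ} (ha : ‖a‖ ≤ 1) (hb : ‖b‖ ≤ 1) (n : ℕ) :
    ‖a ^ n - b ^ n‖ ≤ n * ‖a - b‖ := by
  induction n with
  | zero => simp
  | succ n ih =>
    rw [pow_succ, pow_succ]
    refine (norm_mul_sub_mul_le ?_ hb).trans ?_
    · rw [norm_pow]; exact pow_le_one₀ (norm_nonneg _) ha
    · push_cast; linarith

/-- Along a path of positive probability from 0 to `x`, each of the `n` steps has its character
within a multiple of `g` of `φ`; the product telescopes. -/
theorem exists_norm_chr_sub_pow_le {n : ℕ} {x : ℤ × ℤ} (hx : 0 < transProb p n x) :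
    ∃ C : ℝ, 0 ≤ C ∧ ∀ θ, ‖chr θ x - fourierTr (inc p) θ ^ n‖ ≤ C * defect p θ := by
  induction n generalizing x with
  | zero =>
    rw [transProb_zero] at hx
    have : x = 0 := by by_contra h; simp [h] at hx
    exact ⟨0, le_rfl, fun θ => by simp [this, chr_zero]⟩
  | succ n ih =>
    rw [transProb_succ] at hx
    obtain ⟨y, hy⟩ : ∃ y, transProb p n y * (p (x - y)).toReal ≠ 0 := by
      by_contra! h
      simp [h] at hx
    have hy1 := (transProb_nonneg p n y).lt_of_ne' (left_ne_zero_of_mul hy)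
    have hy2 : 0 < (p (x - y)).toReal :=
      ENNReal.toReal_nonneg.lt_of_ne' (right_ne_zero_of_mul hy)
    obtain ⟨C, hC, h⟩ := ih hy1
    refine ⟨C + 1 / Real.sqrt (p (x - y)).toReal, by positivity, fun θ => ?_⟩
    have : chr θ x = chr θ y * chr θ (x - y) := by rw [← chr_add]; congr 1; abel
    rw [this, pow_succ, add_mul]
    exact (norm_mul_sub_mul_le (norm_chr θ y).le (norm_fourierTr_inc_le_one p θ)).trans
      (add_le_add (h θ) (norm_chr_sub_le p θ hy2))

/-- The lattice points `z` for which `|1 - exp (2 π i θ · z)|` is controlled by the defect of the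
characteristic function. -/
def controlled (p : PMF (ℤ × ℤ)) : AddSubgroup (ℤ × ℤ) where
  carrier := {z | ∃ C : ℝ, 0 ≤ C ∧ ∀ θ, ‖1 - chr θ z‖ ≤ C * defect p θ}
  zero_mem' := ⟨0, le_rfl, fun θ => by simp [chr_zero]⟩
  add_mem' := by
    rintro z w ⟨C, hC, hz⟩ ⟨D, hD, hw⟩
    refine ⟨C + D, by positivity, fun θ => ?_⟩
    rw [chr_add, add_mul]
    have := norm_mul_sub_mul_le (a := 1) (b := 1) (c := chr θ z) (d := chr θ w) (by simp)
      (norm_chr θ w).le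
    rw [one_mul] at this
    exact this.trans (add_le_add (hz θ) (hw θ))
  neg_mem' := by
    rintro z ⟨C, hC, hz⟩
    refine ⟨C, hC, fun θ => ?_⟩
    have h1 : chr θ z * chr θ (-z) = 1 := by rw [← chr_add]; simp [chr_zero]
    have h2 : 1 - chr θ (-z) = -(1 - chr θ z) * chr θ (-z) := by linear_combination -h1
    rw [h2, norm_mul, norm_neg, norm_chr, mul_one]
    exact hz θ

theorem mem_controlled {z : ℤ × ℤ} :
    z ∈ controlled p ↔ ∃ C : ℝ, 0 ≤ C ∧ ∀ θ, ‖1 - chr θ z‖ ≤ C * defect p θ := Iff.rfl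

/-- Both `χ(x)` and `χ(x+z)` lie within a multiple of `g` of the same power `φⁿ`. -/
theorem mem_controlled_of_pos {n : ℕ} {x z : ℤ × ℤ}
    (h : 0 < transProb p n x * transProb p n (x + z)) : z ∈ controlled p := by
  have hx := (transProb_nonneg p n x).lt_of_ne' (left_ne_zero_of_mul h.ne')
  have hz := (transProb_nonneg p n (x + z)).lt_of_ne' (right_ne_zero_of_mul h.ne')
  obtain ⟨C, hC, h1⟩ := exists_norm_chr_sub_pow_le hx
  obtain ⟨D, hD, h2⟩ := exists_norm_chr_sub_pow_le hz
  refine ⟨C + D, by positivity, fun θ => ?_⟩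
  have : ‖1 - chr θ z‖ = ‖chr θ x - chr θ (x + z)‖ := by
    rw [chr_add, show chr θ x - chr θ x * chr θ z = chr θ x * (1 - chr θ z) by ring, norm_mul,
      norm_chr, one_mul]
  rw [this, add_mul]
  refine (norm_sub_le_norm_sub_add_norm_sub _ (fourierTr (inc p) θ ^ n) _).trans ?_
  rw [norm_sub_rev (fourierTr (inc p) θ ^ n)]
  exact add_le_add (h1 θ) (h2 θ)

theorem norm_one_sub_chr_nsmul_le (θ : ℝ × ℝ) (k : ℕ) (z : ℤ × ℤ) :
    ‖1 - chr θ (k • z)‖ ≤ k * ‖1 - chr θ z‖ := by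
  have h : chr θ (k • z) = chr θ z ^ k := by
    induction k with
    | zero => simp [chr_zero]
    | succ k ih => rw [succ_nsmul, chr_add, ih, pow_succ]
  have := norm_pow_sub_pow_le (a := 1) (b := chr θ z) (by simp) (norm_chr θ z).le k
  rwa [one_pow, ← h] at this

theorem norm_one_sub_chr_neg (θ : ℝ × ℝ) (z : ℤ × ℤ) : ‖1 - chr θ (-z)‖ = ‖1 - chr θ z‖ := by
  have h1 : chr θ z * chr θ (-z) = 1 := by rw [← chr_add]; simp [chr_zero]
  have h2 : 1 - chr θ (-z) = -(1 - chr θ z) * chr θ (-z) := by linear_combination -h1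
  rw [h2, norm_mul, norm_neg, norm_chr, mul_one]

theorem norm_one_sub_chr_zsmul_le (θ : ℝ × ℝ) (k : ℤ) (z : ℤ × ℤ) :
    ‖1 - chr θ (k • z)‖ ≤ |(k : ℝ)| * ‖1 - chr θ z‖ := by
  obtain ⟨m, rfl | rfl⟩ := k.eq_nat_or_neg
  · simpa using norm_one_sub_chr_nsmul_le θ m z
  · simpa [norm_one_sub_chr_neg] using norm_one_sub_chr_nsmul_le θ m z

/-- Periodicity may keep `x` itself out of the subgroup. If `x` is reached at time `a` and `-x` at
time `b`, then `φ^(a+b) ≈ χ(x) χ(-x) = 1` up to a multiple of `g`, and so `χ(x)^(a+b) ≈ φ^(a(a+b)) ≈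
1`. -/
theorem exists_nsmul_mem_controlled (hirr : IsIrreducible p) (x : ℤ × ℤ) :
    ∃ N : ℕ, 0 < N ∧ N • x ∈ controlled p := by
  obtain ⟨a, ha⟩ := hirr x
  obtain ⟨b, hb⟩ := hirr (-x)
  rcases Nat.eq_zero_or_pos (a + b) with h0 | h0
  · obtain rfl : a = 0 := by omega
    rw [transProb_zero] at ha
    have : x = 0 := by by_contra h; simp [h] at ha
    exact ⟨1, one_pos, by simp [this, (controlled p).zero_mem]⟩
  obtain ⟨A, hA, h1⟩ := exists_norm_chr_sub_pow_le ha
  obtain ⟨B, hB, h2⟩ := exists_norm_chr_sub_pow_le hb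
  -- The first term of the constant comes from raising `χ(x) ≈ φ^a` to the power `a + b`, the second
  -- from raising `φ^(a+b) ≈ 1` to the power `a`.
  refine ⟨a + b, h0, ((a + b : ℕ) : ℝ) * A + a * (A + B), by positivity, fun θ => ?_⟩
  set φ := fourierTr (inc p) θ
  have hφ : ‖φ‖ ≤ 1 := norm_fourierTr_inc_le_one p θ
  have hpow : ∀ k : ℕ, ‖φ ^ k‖ ≤ 1 := fun k => by
    rw [norm_pow]; exact pow_le_one₀ (norm_nonneg _) hφ
  have hx : chr θ ((a + b) • x) = chr θ x ^ (a + b) := by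
    induction a + b with
    | zero => simp [chr_zero]
    | succ k ih => rw [succ_nsmul, chr_add, ih, pow_succ]
  have h3 : ‖1 - φ ^ (a + b)‖ ≤ (A + B) * defect p θ := by
    have h4 : chr θ x * chr θ (-x) = 1 := by rw [← chr_add]; simp [chr_zero]
    rw [← h4, pow_add, add_mul]
    exact (norm_mul_sub_mul_le (norm_chr θ x).le (hpow b)).trans (add_le_add (h1 θ) (h2 θ))
  have h5 : ‖1 - (φ ^ (a + b)) ^ a‖ ≤ a * ((A + B) * defect p θ) := by
    have := norm_pow_sub_pow_le (a := 1) (by simp) (hpow (a + b)) a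
    rw [one_pow] at this
    exact this.trans (mul_le_mul_of_nonneg_left h3 (Nat.cast_nonneg a))
  have h6 : ‖(φ ^ a) ^ (a + b) - chr θ x ^ (a + b)‖ ≤ (a + b : ℕ) * (A * defect p θ) := by
    refine (norm_pow_sub_pow_le (hpow a) (norm_chr θ x).le (a + b)).trans ?_
    rw [norm_sub_rev]
    exact mul_le_mul_of_nonneg_left (h1 θ) (Nat.cast_nonneg _)
  rw [hx]
  refine (norm_sub_le_norm_sub_add_norm_sub _ ((φ ^ (a + b)) ^ a) _).trans ?_
  rw [← pow_mul, mul_comm (a + b) a, pow_mul] at h5 ⊢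
  linarith

theorem exists_nat_axes_mem_controlled (hirr : IsIrreducible p) :
    ∃ D : ℕ, 0 < D ∧ ((D : ℤ), (0 : ℤ)) ∈ controlled p ∧ ((0 : ℤ), (D : ℤ)) ∈ controlled p := by
  obtain ⟨M, hM, h1⟩ := exists_nsmul_mem_controlled hirr (1, 0)
  obtain ⟨N, hN, h2⟩ := exists_nsmul_mem_controlled hirr (0, 1)
  refine ⟨M * N, Nat.mul_pos hM hN, ?_, ?_⟩
  · have := (controlled p).nsmul_mem h1 N
    rw [← mul_nsmul] at this
    simpa using this
  · have := (controlled p).nsmul_mem h2 M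
    rw [← mul_nsmul, mul_comm] at this
    simpa using this

theorem enorm2_nonneg (z : ℤ × ℤ) : 0 ≤ enorm2 z := Real.sqrt_nonneg _

theorem sq_enorm2 (z : ℤ × ℤ) : enorm2 z ^ 2 = (z.1 : ℝ) ^ 2 + (z.2 : ℝ) ^ 2 :=
  Real.sq_sqrt (by positivity)

theorem one_le_enorm2 {z : ℤ × ℤ} (hz : z ≠ 0) : 1 ≤ enorm2 z := by
  rw [enorm2, Real.one_le_sqrt]
  have h : z.1 ≠ 0 ∨ z.2 ≠ 0 := by
    by_contra! h
    exact hz (Prod.ext h.1 h.2)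
  have : (1 : ℤ) ≤ z.1 ^ 2 + z.2 ^ 2 := by
    rcases h with h | h
    · nlinarith [sq_nonneg z.2, Int.one_le_abs h, sq_abs z.1, abs_nonneg z.1]
    · nlinarith [sq_nonneg z.1, Int.one_le_abs h, sq_abs z.2, abs_nonneg z.2]
  exact_mod_cast this

theorem abs_fst_le_enorm2 (z : ℤ × ℤ) : |(z.1 : ℝ)| ≤ enorm2 z :=
  Real.abs_le_sqrt (by nlinarith [sq_nonneg (z.2 : ℝ)])

theorem abs_snd_le_enorm2 (z : ℤ × ℤ) : |(z.2 : ℝ)| ≤ enorm2 z :=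
  Real.abs_le_sqrt (by nlinarith [sq_nonneg (z.1 : ℝ)])

/-- The subgroup contains `(D, 0)` and `(0, D)`. Dividing the coordinates of `z` by `D` costs
linearly in `‖z‖`, and leaves one of finitely many controlled remainders, whose constants are
absorbed by `‖z‖ ≥ 1`. -/
theorem exists_uniform_control (hirr : IsIrreducible p) :
    ∃ C : ℝ, 0 ≤ C ∧ ∀ z ∈ controlled p, ∀ θ,
      ‖1 - chr θ z‖ ≤ C * enorm2 z * defect p θ := by
  obtain ⟨D, hD, h1, h2⟩ := exists_nat_axes_mem_controlled hirr
  obtain ⟨A, hA, hA'⟩ := mem_controlled.1 h1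
  obtain ⟨B, hB, hB'⟩ := mem_controlled.1 h2
  have hr : ∀ r : ℤ × ℤ, ∃ C : ℝ, 0 ≤ C ∧ (r ∈ controlled p → ∀ θ,
      ‖1 - chr θ r‖ ≤ C * defect p θ) := by
    intro r
    by_cases h : r ∈ controlled p
    · obtain ⟨C, hC, h'⟩ := mem_controlled.1 h
      exact ⟨C, hC, fun _ => h'⟩
    · exact ⟨0, le_rfl, fun h' => absurd h' h⟩
  choose c hc hc' using hr
  set s : Finset (ℤ × ℤ) := Finset.Icc 0 (D : ℤ) ×ˢ Finset.Icc 0 (D : ℤ)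
  have hE : 0 ≤ ∑ r ∈ s, c r := Finset.sum_nonneg fun r _ => hc r
  refine ⟨A + B + ∑ r ∈ s, c r, by positivity, fun z hz θ => ?_⟩
  have hg := defect_nonneg p θ
  by_cases hz0 : z = 0
  · rw [hz0, chr_zero, sub_self, norm_zero]
    have := enorm2_nonneg 0
    positivity
  have hz1 := one_le_enorm2 hz0
  set D' : ℤ := (D : ℤ)
  have hD' : 0 < D' := Int.natCast_pos.2 hD
  set r : ℤ × ℤ := (z.1 % D', z.2 % D')
  have hdec : z = (z.1 / D') • (D', (0 : ℤ)) + (z.2 / D') • ((0 : ℤ), D') + r := by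
    ext
    · simp only [r, Prod.fst_add, Prod.smul_fst, smul_eq_mul, mul_zero, add_zero]
      linarith [Int.ediv_mul_add_emod z.1 D']
    · simp only [r, Prod.snd_add, Prod.smul_snd, smul_eq_mul, mul_zero, zero_add]
      linarith [Int.ediv_mul_add_emod z.2 D']
  have hrm : r ∈ controlled p := by
    have : r = z - ((z.1 / D') • (D', (0 : ℤ)) + (z.2 / D') • ((0 : ℤ), D')) := by
      rw [eq_sub_iff_add_eq, add_comm]
      exact hdec.symm
    rw [this]
    exact (controlled p).sub_mem hz ((controlled p).add_mem ((controlled p).zsmul_mem h1 _)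
      ((controlled p).zsmul_mem h2 _))
  have hrs : r ∈ s := by
    simp only [s, r, Finset.mem_product, Finset.mem_Icc]
    exact ⟨⟨Int.emod_nonneg _ hD'.ne', (Int.emod_lt_of_pos _ hD').le⟩,
      Int.emod_nonneg _ hD'.ne', (Int.emod_lt_of_pos _ hD').le⟩
  have hq : ∀ k : ℤ, |((k / D' : ℤ) : ℝ)| ≤ |(k : ℝ)| := by
    intro k
    exact_mod_cast Int.abs_ediv_le_abs k D'
  have b1 : ‖1 - chr θ ((z.1 / D') • (D', (0 : ℤ)))‖ ≤ enorm2 z * (A * defect p θ) :=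
    (norm_one_sub_chr_zsmul_le θ _ _).trans (mul_le_mul ((hq _).trans (abs_fst_le_enorm2 z))
      (hA' θ) (norm_nonneg _) (enorm2_nonneg z))
  have b2 : ‖1 - chr θ ((z.2 / D') • ((0 : ℤ), D'))‖ ≤ enorm2 z * (B * defect p θ) :=
    (norm_one_sub_chr_zsmul_le θ _ _).trans (mul_le_mul ((hq _).trans (abs_snd_le_enorm2 z))
      (hB' θ) (norm_nonneg _) (enorm2_nonneg z))
  have b3 : ‖1 - chr θ r‖ ≤ enorm2 z * ((∑ r ∈ s, c r) * defect p θ) := by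
    refine (hc' r hrm θ).trans ?_
    have : c r ≤ ∑ r ∈ s, c r := Finset.single_le_sum (fun i _ => hc i) hrs
    have h3 := mul_le_mul_of_nonneg_right this hg
    have h4 : 0 ≤ (∑ r ∈ s, c r) * defect p θ := by positivity
    nlinarith
  have hadd : ∀ u v, ‖1 - chr θ (u + v)‖ ≤ ‖1 - chr θ u‖ + ‖1 - chr θ v‖ := by
    intro u v
    have := norm_mul_sub_mul_le (a := 1) (b := 1) (c := chr θ u) (d := chr θ v) (by simp)
      (norm_chr θ v).le
    rwa [one_mul, ← chr_add] at this
  have b4 := hadd ((z.1 / D') • (D', (0 : ℤ)) + (z.2 / D') • ((0 : ℤ), D')) r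
  rw [← hdec] at b4
  have b5 := hadd ((z.1 / D') • (D', (0 : ℤ))) ((z.2 / D') • ((0 : ℤ), D'))
  linarith

end Control

/-! ### Fourier inversion on the unit square. -/

/-- Lebesgue measure on the unit square. -/
def torus : Measure (ℝ × ℝ) :=
  (volume.restrict (Set.Ioc (0 : ℝ) 1)).prod (volume.restrict (Set.Ioc (0 : ℝ) 1))

instance : IsProbabilityMeasure (volume.restrict (Set.Ioc (0 : ℝ) 1)) := ⟨by simp⟩

instance : IsProbabilityMeasure torus := by unfold torus; infer_instance

theorem integral_unit_exp (m : ℤ) :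
    ∫ t in Set.Ioc (0 : ℝ) 1, Complex.exp (((2 * Real.pi * (t * m) : ℝ) : ℂ) * Complex.I)
      = if m = 0 then 1 else 0 := by
  split_ifs with h
  · simp [h]
  · rw [← intervalIntegral.integral_of_le zero_le_one]
    have hc : (2 * Real.pi * m * Complex.I : ℂ) ≠ 0 := by
      simp [h, Real.pi_ne_zero]
    have := integral_exp_mul_complex (a := 0) (b := 1) hc
    have h1 : Complex.exp (2 * Real.pi * m * Complex.I) = 1 := by
      rw [← Complex.exp_int_mul_two_pi_mul_I m]; congr 1; ring
    simp only [Complex.ofReal_one, mul_one, Complex.ofReal_zero, mul_zero, Complex.exp_zero, h1,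
      sub_self, zero_div] at this
    rw [← this]
    refine intervalIntegral.integral_congr fun t _ => ?_
    congr 1
    push_cast
    ring

theorem integral_chr (w : ℤ × ℤ) : ∫ θ, chr θ w ∂torus = if w = 0 then 1 else 0 := by
  have h : ∀ θ : ℝ × ℝ, chr θ w
      = Complex.exp (((2 * Real.pi * (θ.1 * w.1) : ℝ) : ℂ) * Complex.I)
        * Complex.exp (((2 * Real.pi * (θ.2 * w.2) : ℝ) : ℂ) * Complex.I) := by
    intro θ
    rw [chr, ← Complex.exp_add]
    congr 1
    push_cast
    ring
  simp only [h]
  rw [torus, integral_prod_mul (fun t : ℝ =>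
      Complex.exp (((2 * Real.pi * (t * w.1) : ℝ) : ℂ) * Complex.I)) (fun t : ℝ =>
      Complex.exp (((2 * Real.pi * (t * w.2) : ℝ) : ℂ) * Complex.I)),
    integral_unit_exp, integral_unit_exp]
  by_cases h1 : w.1 = 0 <;> by_cases h2 : w.2 = 0 <;> simp [Prod.ext_iff, h1, h2]

theorem integrable_torus_of_continuous {E : Type*} [NormedAddCommGroup E]
    {f : ℝ × ℝ → E} (hf : Continuous f) : Integrable f torus := by
  have h1 : IntegrableOn f (Set.Icc (0 : ℝ) 1 ×ˢ Set.Icc (0 : ℝ) 1) volume :=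
    hf.continuousOn.integrableOn_compact (isCompact_Icc.prod isCompact_Icc)
  have h2 := h1.mono_set (Set.prod_mono (Set.Ioc_subset_Icc_self (a := (0 : ℝ)) (b := 1))
    (Set.Ioc_subset_Icc_self (a := (0 : ℝ)) (b := 1)))
  rwa [IntegrableOn, Measure.volume_eq_prod, ← Measure.prod_restrict] at h2

theorem fourierTr_inversion {a : ℤ × ℤ → ℂ} (ha : Summable a) (x : ℤ × ℤ) :
    ∫ θ, fourierTr a θ * chr θ (-x) ∂torus = a x := by
  have h1 : ∀ w, ∫ θ, a w * chr θ w * chr θ (-x) ∂torus = if w = x then a w else 0 := by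
    intro w
    simp only [mul_assoc, ← chr_add]
    rw [integral_const_mul, integral_chr, ← sub_eq_add_neg]
    simp [sub_eq_zero]
  have hi : ∀ w, Integrable (fun θ => a w * chr θ w * chr θ (-x)) torus := fun w =>
    integrable_torus_of_continuous
      ((continuous_const.mul (continuous_chr w)).mul (continuous_chr (-x)))
  have hn : ∀ w θ, ‖a w * chr θ w * chr θ (-x)‖ = ‖a w‖ := by
    intro w θ; simp [norm_chr]
  have h2 := integral_tsum_of_summable_integral_norm hi (by simpa only [hn, integral_const,
    probReal_univ, one_smul] using ha.norm)
  simp only [h1, tsum_ite_eq] at h2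
  rw [h2]
  refine integral_congr_ae (ae_of_all _ fun θ => ?_)
  simp only [fourierTr, tsum_mul_right]

theorem norm_apply_le_integral {a : ℤ × ℤ → ℂ} (ha : Summable a) (x : ℤ × ℤ) :
    ‖a x‖ ≤ ∫ θ, ‖fourierTr a θ‖ ∂torus := by
  rw [← fourierTr_inversion ha x]
  refine (norm_integral_le_integral_norm _).trans_eq ?_
  simp [norm_chr]

theorem norm_sub_le_integral {a : ℤ × ℤ → ℂ} (ha : Summable a) (x z : ℤ × ℤ) :
    ‖a x - a (x + z)‖ ≤ ∫ θ, ‖fourierTr a θ‖ * ‖1 - chr θ z‖ ∂torus := by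
  have hi : ∀ y, Integrable (fun θ => fourierTr a θ * chr θ (-y)) torus := fun y =>
    integrable_torus_of_continuous ((continuous_fourierTr ha).mul (continuous_chr (-y)))
  rw [← fourierTr_inversion ha x, ← fourierTr_inversion ha (x + z), ← integral_sub (hi _) (hi _)]
  refine (norm_integral_le_integral_norm _).trans_eq ?_
  congr 1
  ext θ
  have : chr θ (-x) = chr θ (-(x + z)) * chr θ z := by rw [← chr_add]; congr 1; abel
  rw [this, show fourierTr a θ * (chr θ (-(x + z)) * chr θ z) - fourierTr a θ * chr θ (-(x + z))
    = fourierTr a θ * chr θ (-(x + z)) * -(1 - chr θ z) by ring, norm_mul, norm_mul, norm_chr,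
    norm_neg, mul_one]

/-! ### Integrals of Gaussian factors in the defect. -/

theorem integral_unit_exp_cos_le {b : ℝ} (hb : 0 < b) {D : ℕ} (hD : 0 < D) :
    ∫ t in Set.Ioc (0 : ℝ) 1, Real.exp (-(b * (1 - Real.cos (2 * Real.pi * (D * t)))))
      ≤ Real.sqrt (Real.pi / (8 * b)) := by
  set f : ℝ → ℝ := fun u => Real.exp (-(b * (1 - Real.cos (2 * Real.pi * u)))) with hf
  have hper : Function.Periodic f 1 := by
    intro u
    simp only [hf]
    rw [mul_add, mul_one, Real.cos_add_two_pi]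
  have hD0 : (D : ℝ) ≠ 0 := by exact_mod_cast hD.ne'
  have hcont : Continuous f := by fun_prop
  -- The scaled integral runs over `D` periods, hence equals that over one period. Centring this
  -- period at 0 makes `1 - cos(2πu) ≥ 8u²` available throughout.
  have e1 : ∫ t in Set.Ioc (0 : ℝ) 1, f (D * t) = ∫ u in (-(1 / 2) : ℝ)..(-(1 / 2) + 1), f u := by
    rw [← intervalIntegral.integral_of_le zero_le_one,
      intervalIntegral.integral_comp_mul_left f hD0]
    have := hper.intervalIntegral_add_zsmul_eq (D : ℤ) 0
      (fun _ _ => hcont.intervalIntegrable _ _)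
    simp only [zero_add, zsmul_eq_mul, Int.cast_natCast, mul_one] at this
    rw [mul_zero, mul_one, this, smul_eq_mul, inv_mul_cancel_left₀ hD0]
    have := hper.intervalIntegral_add_eq 0 (-(1 / 2))
    rwa [zero_add] at this
  change ∫ t in Set.Ioc (0 : ℝ) 1, f (D * t) ≤ _
  rw [e1, ← integral_gaussian, intervalIntegral.integral_of_le (by norm_num)]
  have hg : Integrable fun u : ℝ => Real.exp (-(8 * b) * u ^ 2) :=
    integrable_exp_neg_mul_sq (by positivity)
  refine le_trans ?_ (setIntegral_le_integral (s := Set.Ioc (-(1 / 2) : ℝ) (-(1 / 2) + 1)) hg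
    (ae_of_all _ fun u => (Real.exp_pos _).le))
  refine setIntegral_mono_on (hcont.integrableOn_Ioc) hg.integrableOn measurableSet_Ioc
    fun u hu => ?_
  refine Real.exp_le_exp.2 ?_
  have hu' : |2 * Real.pi * u| ≤ Real.pi := by
    have h1 : |u| ≤ 1 / 2 := abs_le.2 ⟨hu.1.le, by linarith [hu.2]⟩
    rw [abs_mul, abs_of_pos Real.two_pi_pos]
    nlinarith [Real.pi_pos]
  have hcos := Real.cos_le_one_sub_mul_cos_sq hu'
  have hpi := Real.pi_pos.ne'
  have : 2 / Real.pi ^ 2 * (2 * Real.pi * u) ^ 2 = 8 * u ^ 2 := by field_simp; ring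
  rw [this] at hcos
  nlinarith

theorem normSq_one_sub_chr (θ : ℝ × ℝ) (z : ℤ × ℤ) :
    ‖1 - chr θ z‖ ^ 2 = 2 * (1 - Real.cos (2 * Real.pi * (θ.1 * z.1 + θ.2 * z.2))) := by
  rw [← Complex.normSq_eq_norm_sq, Complex.normSq_sub, Complex.normSq_eq_norm_sq (chr θ z),
    norm_chr, map_one, one_mul, Complex.conj_re, chr, Complex.exp_ofReal_mul_I_re]
  ring

/-- Control of `(D, 0)` and `(0, D)` bounds `g²` below by a multiple of a sum of two terms `1 -
cos(2πD θᵢ)`. The integral then factorizes, and each coordinate contributes a factor of order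
`n^(-1/2)`. -/
theorem exists_integral_exp_defect_le {p : PMF (ℤ × ℤ)} (hirr : IsIrreducible p) :
    ∃ C : ℝ, 0 < C ∧ ∀ n : ℕ, 0 < n →
      ∫ θ, Real.exp (-(n * defect p θ ^ 2 / 4)) ∂torus ≤ C / n := by
  obtain ⟨D, hD, h1, h2⟩ := exists_nat_axes_mem_controlled hirr
  obtain ⟨A, hA, hA'⟩ := mem_controlled.1 h1
  obtain ⟨B, hB, hB'⟩ := mem_controlled.1 h2
  -- The summand 1 only serves to make `M` positive, since `A` and `B` may be zero.
  set M : ℝ := A ^ 2 + B ^ 2 + 1 with hM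
  have hM0 : 0 < M := by positivity
  have hpi := Real.pi_pos
  refine ⟨Real.pi / 4 * M, by positivity, fun n hn => ?_⟩
  have hn' : (0 : ℝ) < n := by exact_mod_cast hn
  set b : ℝ := n / (2 * M) with hb
  have hb0 : 0 < b := by positivity
  set h : ℝ → ℝ := fun t => Real.exp (-(b * (1 - Real.cos (2 * Real.pi * (D * t))))) with hh
  have hle : ∀ θ : ℝ × ℝ, Real.exp (-(n * defect p θ ^ 2 / 4)) ≤ h θ.1 * h θ.2 := by
    intro θ
    rw [hh, ← Real.exp_add]
    refine Real.exp_le_exp.2 ?_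
    have a1 := pow_le_pow_left₀ (norm_nonneg _) (hA' θ) 2
    have a2 := pow_le_pow_left₀ (norm_nonneg _) (hB' θ) 2
    rw [normSq_one_sub_chr] at a1 a2
    simp only [Int.cast_zero, mul_zero, add_zero, zero_add, Int.cast_natCast, mul_pow] at a1 a2
    rw [mul_comm θ.1] at a1
    rw [mul_comm θ.2] at a2
    have a3 : 2 * ((1 - Real.cos (2 * Real.pi * (D * θ.1)))
        + (1 - Real.cos (2 * Real.pi * (D * θ.2)))) ≤ M * defect p θ ^ 2 := by
      rw [hM]; nlinarith [sq_nonneg (defect p θ)]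
    have a4 := mul_le_mul_of_nonneg_left a3 (show 0 ≤ n / (4 * M) by positivity)
    have a5 : n / (4 * M) * (M * defect p θ ^ 2) = n * defect p θ ^ 2 / 4 := by
      field_simp
    have a6 : n / (4 * M) * (2 * ((1 - Real.cos (2 * Real.pi * (D * θ.1)))
        + (1 - Real.cos (2 * Real.pi * (D * θ.2))))) =
        b * (1 - Real.cos (2 * Real.pi * (D * θ.1)))
          + b * (1 - Real.cos (2 * Real.pi * (D * θ.2))) := by
      rw [hb]; field_simp; ring
    linarith
  have hcd := continuous_defect p
  have hch : Continuous h := by fun_prop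
  refine (integral_mono (integrable_torus_of_continuous (by fun_prop))
    (integrable_torus_of_continuous (by fun_prop)) hle).trans ?_
  rw [torus, integral_prod_mul]
  have h3 := integral_unit_exp_cos_le hb0 hD
  have h4 : 0 ≤ ∫ t in Set.Ioc (0 : ℝ) 1, h t := integral_nonneg fun t => (Real.exp_pos _).le
  refine (mul_le_mul h3 h3 h4 (Real.sqrt_nonneg _)).trans_eq ?_
  rw [Real.mul_self_sqrt (by positivity), hb]
  field_simp
  norm_num

/-- A bound absorbing powers of `s` into a Gaussian factor. -/
theorem pow_mul_exp_neg_le {s P : ℝ}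
    (hP : P ≤ 32 * (1 + s ^ 2 / 4 + (s ^ 2 / 4) ^ 2 / 2)) :
    P * Real.exp (-(s ^ 2 / 2)) ≤ 32 * Real.exp (-(s ^ 2 / 4)) := by
  have h := Real.quadratic_le_exp_of_nonneg (show 0 ≤ s ^ 2 / 4 by positivity)
  have h1 : Real.exp (-(s ^ 2 / 4)) = Real.exp (s ^ 2 / 4) * Real.exp (-(s ^ 2 / 2)) := by
    rw [← Real.exp_add]; congr 1; ring
  rw [h1, ← mul_assoc]
  exact mul_le_mul_of_nonneg_right (hP.trans (by linarith)) (Real.exp_pos _).le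

/-! ### Local estimates for the transition probabilities and their second moments. -/

section Gauss

variable {n : ℕ} {g : ℝ}

/-- In this and the next two bounds `s = √n g` is the natural variable. Half of the exponent absorbs
the polynomial in `s`; the other half is kept for the integral over the square. -/
theorem moment_mul_exp_le :
    (n + n ^ 2 * g ^ 2) * Real.exp (-(n * g ^ 2 / 2)) ≤ 32 * n * Real.exp (-(n * g ^ 2 / 4)) := by
  have hs := Real.sq_sqrt (Nat.cast_nonneg n : (0 : ℝ) ≤ n)
  have h := pow_mul_exp_neg_le (s := Real.sqrt n * g) (P := 1 + n * g ^ 2) (by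
    rw [mul_pow, hs]
    nlinarith [mul_nonneg (Nat.cast_nonneg n : (0 : ℝ) ≤ n) (sq_nonneg g), sq_nonneg (n * g ^ 2)])
  rw [mul_pow, hs] at h
  have := mul_le_mul_of_nonneg_left h (Nat.cast_nonneg n : (0 : ℝ) ≤ n)
  linarith

theorem mul_exp_le (hn : 0 < n) :
    g * Real.exp (-(n * g ^ 2 / 2)) ≤ 32 / Real.sqrt n * Real.exp (-(n * g ^ 2 / 4)) := by
  have hs := Real.sq_sqrt (Nat.cast_nonneg n : (0 : ℝ) ≤ n)
  have hs0 : 0 < Real.sqrt n := Real.sqrt_pos.2 (by exact_mod_cast hn)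
  have h := pow_mul_exp_neg_le (s := Real.sqrt n * g) (P := Real.sqrt n * g) (by
    nlinarith [sq_nonneg (Real.sqrt n * g - 1), sq_nonneg ((Real.sqrt n * g) ^ 2)])
  rw [mul_pow, hs] at h
  rw [div_mul_eq_mul_div, le_div_iff₀ hs0]
  linarith

theorem moment_mul_mul_exp_le :
    (n + n ^ 2 * g ^ 2) * g * Real.exp (-(n * g ^ 2 / 2))
      ≤ 32 * Real.sqrt n * Real.exp (-(n * g ^ 2 / 4)) := by
  have hs := Real.sq_sqrt (Nat.cast_nonneg n : (0 : ℝ) ≤ n)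
  have hs0 := Real.sqrt_nonneg (n : ℝ)
  have h := pow_mul_exp_neg_le (s := Real.sqrt n * g)
    (P := Real.sqrt n * g + (Real.sqrt n * g) ^ 3) (by
      nlinarith [sq_nonneg (Real.sqrt n * g - 1), sq_nonneg ((Real.sqrt n * g) ^ 2),
        sq_nonneg (Real.sqrt n * g * (Real.sqrt n * g - 1))])
  have hm := mul_le_mul_of_nonneg_left h hs0
  have e : (n + n ^ 2 * g ^ 2) * g
      = Real.sqrt n * (Real.sqrt n * g + (Real.sqrt n * g) ^ 3) := by
    nth_rewrite 1 2 [← hs]; ring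
  rw [e]
  rw [mul_pow (Real.sqrt n) g 2, hs] at hm
  linarith

end Gauss

section Local

variable {p : PMF (ℤ × ℤ)} {n : ℕ} {a : ℤ × ℤ → ℂ} {J K : ℝ}

theorem integrable_exp_defect (p : PMF (ℤ × ℤ)) (n : ℕ) :
    Integrable (fun θ => Real.exp (-(n * defect p θ ^ 2 / 4))) torus := by
  have := continuous_defect p
  exact integrable_torus_of_continuous (by fun_prop)

theorem norm_apply_le_of_fourierTr_le
    (hJ : ∫ θ, Real.exp (-(n * defect p θ ^ 2 / 4)) ∂torus ≤ J / n) (hK : 0 ≤ K)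
    (ha : Summable a)
    (h : ∀ θ, ‖fourierTr a θ‖ ≤ K * Real.exp (-(n * defect p θ ^ 2 / 4))) (x : ℤ × ℤ) :
    ‖a x‖ ≤ K * (J / n) := by
  refine (norm_apply_le_integral ha x).trans ?_
  refine (integral_mono (integrable_torus_of_continuous (continuous_fourierTr ha).norm)
    ((integrable_exp_defect p n).const_mul K) h).trans ?_
  rw [integral_const_mul]
  exact mul_le_mul_of_nonneg_left hJ hK

theorem norm_sub_le_of_fourierTr_le
    (hJ : ∫ θ, Real.exp (-(n * defect p θ ^ 2 / 4)) ∂torus ≤ J / n) (hK : 0 ≤ K)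
    (ha : Summable a) {z : ℤ × ℤ}
    (h : ∀ θ, ‖fourierTr a θ‖ * ‖1 - chr θ z‖ ≤ K * Real.exp (-(n * defect p θ ^ 2 / 4)))
    (x : ℤ × ℤ) :
    ‖a x - a (x + z)‖ ≤ K * (J / n) := by
  refine (norm_sub_le_integral ha x z).trans ?_
  refine (integral_mono (integrable_torus_of_continuous ((continuous_fourierTr ha).norm.mul
      (continuous_const.sub (continuous_chr z)).norm))
    ((integrable_exp_defect p n).const_mul K) h).trans ?_
  rw [integral_const_mul]
  exact mul_le_mul_of_nonneg_left hJ hK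

theorem transProb_le
    (hJ : ∫ θ, Real.exp (-(n * defect p θ ^ 2 / 4)) ∂torus ≤ J / n) (y : ℤ × ℤ) :
    transProb p n y ≤ J / n := by
  have := norm_apply_le_of_fourierTr_le (K := 1) hJ zero_le_one (summable_law p n) (fun θ => by
    rw [one_mul]
    refine (norm_fourierTr_law_le_exp p n θ).trans (Real.exp_le_exp.2 ?_)
    have : 0 ≤ n * defect p θ ^ 2 := by positivity
    linarith) y
  rwa [one_mul, law, Complex.norm_real, Real.norm_of_nonneg (transProb_nonneg p n y)] at this

theorem abs_transProb_sub_le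
    (hJ : ∫ θ, Real.exp (-(n * defect p θ ^ 2 / 4)) ∂torus ≤ J / n) (hn : 0 < n) {z : ℤ × ℤ}
    (hK : 0 ≤ K) (hz : ∀ θ, ‖1 - chr θ z‖ ≤ K * defect p θ) (x : ℤ × ℤ) :
    |transProb p n x - transProb p n (x + z)| ≤ K * (32 / Real.sqrt n) * (J / n) := by
  have := norm_sub_le_of_fourierTr_le (K := K * (32 / Real.sqrt n)) hJ (by positivity)
    (summable_law p n) (z := z) (fun θ => by
      refine (mul_le_mul (norm_fourierTr_law_le_exp p n θ) (hz θ) (norm_nonneg _)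
        (Real.exp_pos _).le).trans ?_
      have := mul_le_mul_of_nonneg_left (mul_exp_le (g := defect p θ) hn) hK
      linarith) x
  rwa [law, law, ← Complex.ofReal_sub, Complex.norm_real, Real.norm_eq_abs] at this

variable {ℓ : ℤ × ℤ →+ ℤ} {V : ℝ}

theorem ofReal_coord_sq_mul_transProb (x : ℤ × ℤ) :
    (ℓ x : ℂ) ^ 2 * law p n x = (((ℓ x : ℝ) ^ 2 * transProb p n x : ℝ) : ℂ) := by
  rw [law]; push_cast; rfl

theorem coord_sq_mul_transProb_le
    (hJ : ∫ θ, Real.exp (-(n * defect p θ ^ 2 / 4)) ∂torus ≤ J / n) (hn : 0 < n)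
    (h1 : HasSum (fun x => (ℓ x : ℝ) * (p x).toReal) 0)
    (h2 : HasSum (fun x => (ℓ x : ℝ) ^ 2 * (p x).toReal) V) (y : ℤ × ℤ) :
    (ℓ y : ℝ) ^ 2 * transProb p n y ≤ 96 * V * J := by
  have hV : 0 ≤ V := h2.nonneg fun _ => by positivity
  have := norm_apply_le_of_fourierTr_le (K := 3 * V * (32 * n)) hJ (by positivity)
    (summable_coord_moments (summable_coord_sq_mul_inc h2) n).2 (fun θ => by
      refine (norm_fourierTr_coord_sq_mul_law_le_exp h1 h2 θ n).trans ?_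
      have := mul_le_mul_of_nonneg_left (moment_mul_exp_le (n := n) (g := defect p θ))
        (show 0 ≤ 3 * V by positivity)
      linarith) y
  rw [ofReal_coord_sq_mul_transProb, Complex.norm_real,
    Real.norm_of_nonneg (mul_nonneg (sq_nonneg _) (transProb_nonneg p n y))] at this
  have hn' : (n : ℝ) ≠ 0 := by exact_mod_cast hn.ne'
  have e : 3 * V * (32 * n) * (J / n) = 96 * V * J := by field_simp; ring
  linarith

theorem abs_coord_sq_mul_transProb_sub_le
    (hJ : ∫ θ, Real.exp (-(n * defect p θ ^ 2 / 4)) ∂torus ≤ J / n)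
    (h1 : HasSum (fun x => (ℓ x : ℝ) * (p x).toReal) 0)
    (h2 : HasSum (fun x => (ℓ x : ℝ) ^ 2 * (p x).toReal) V) {z : ℤ × ℤ}
    (hK : 0 ≤ K) (hz : ∀ θ, ‖1 - chr θ z‖ ≤ K * defect p θ) (x : ℤ × ℤ) :
    |(ℓ x : ℝ) ^ 2 * transProb p n x - (ℓ (x + z) : ℝ) ^ 2 * transProb p n (x + z)|
      ≤ K * (96 * V * Real.sqrt n) * (J / n) := by
  have hV : 0 ≤ V := h2.nonneg fun _ => by positivity
  have := norm_sub_le_of_fourierTr_le (K := K * (96 * V * Real.sqrt n)) hJ (by positivity)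
    (summable_coord_moments (summable_coord_sq_mul_inc h2) n).2 (z := z) (fun θ => by
      refine (mul_le_mul (norm_fourierTr_coord_sq_mul_law_le_exp h1 h2 θ n) (hz θ) (norm_nonneg _)
        (by positivity)).trans ?_
      have := mul_le_mul_of_nonneg_left (moment_mul_mul_exp_le (n := n) (g := defect p θ))
        (show 0 ≤ K * (3 * V) by positivity)
      linarith) x
  rwa [ofReal_coord_sq_mul_transProb, ofReal_coord_sq_mul_transProb, ← Complex.ofReal_sub,
    Complex.norm_real, Real.norm_eq_abs] at this

end Local

/-! ### The gradient bound at a single time. -/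

theorem enorm2_eq_norm (x : ℤ × ℤ) : enorm2 x = ‖(⟨x.1, x.2⟩ : ℂ)‖ := by
  rw [enorm2, Complex.norm_def, Complex.normSq_mk]
  congr 1; ring

theorem enorm2_add_le (x z : ℤ × ℤ) : enorm2 (x + z) ≤ enorm2 x + enorm2 z := by
  rw [enorm2_eq_norm, enorm2_eq_norm, enorm2_eq_norm]
  refine le_trans (le_of_eq ?_) (norm_add_le _ _)
  congr 1
  apply Complex.ext <;> simp

theorem enorm2_neg (x : ℤ × ℤ) : enorm2 (-x) = enorm2 x := by
  simp [enorm2]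

/-- Here `P = p_n(x)`, `Q = p_n(x+z)`, `s = √n`, and `X, Y, Z` are the norms of `x, x+z, z`. Write
`X²(P - Q) = (X²P - Y²Q) + (Y² - X²)Q`. Because `X ≤ Y ≤ X + Z`, the last factor satisfies `0 ≤ Y² -
X² ≤ 2YZ`, and `2Y ≤ Y²/s + s` reduces `2YQ` to the bounds on `Y²Q` and `Q`. -/
theorem abs_sub_le_of_gradient_bounds {X Y Z P Q C U J n s : ℝ} (hn1 : 1 ≤ n) (hs0 : 0 < s)
    (hss : n = s ^ 2) (hX : 0 ≤ X) (hXY : X ≤ Y) (htri : Y ≤ X + Z) (hZ : 0 ≤ Z) (hP : 0 ≤ Q)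
    (hA : Q ≤ J / n) (hA3 : Y ^ 2 * Q ≤ 96 * U * J)
    (hB : |P - Q| ≤ C * Z * (32 / s) * (J / n))
    (hD : |X ^ 2 * P - Y ^ 2 * Q| ≤ C * Z * (96 * U * s) * (J / n)) :
    |P - Q| ≤ (3 * (32 * C * J) + 2 * (96 * C * U * J + (96 * U * J + J))) * Z
      * (1 / (s * ((1 + X) ^ 2 + n))) := by
  have hY0 : 0 ≤ Y := hX.trans hXY
  have key1 : n * |P - Q| ≤ 32 * C * J * (Z / s) := by
    refine (mul_le_mul_of_nonneg_left hB (by linarith)).trans_eq ?_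
    field_simp
  have key2 : |X ^ 2 * P - Y ^ 2 * Q| ≤ 96 * C * U * J * (Z / s) := by
    refine hD.trans_eq ?_
    rw [hss]
    field_simp
  have key3 : 2 * Y * Q ≤ (96 * U * J + J) * (1 / s) := by
    have e1 : 2 * Y ≤ Y ^ 2 / s + s := by
      rw [div_add' _ _ _ hs0.ne', le_div_iff₀ hs0]
      nlinarith [sq_nonneg (Y - s)]
    have e2 := mul_le_mul_of_nonneg_right e1 hP
    have e3 : s * Q ≤ J / s := by
      refine (mul_le_mul_of_nonneg_left hA hs0.le).trans_eq ?_
      rw [hss]; field_simp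
    have e4 : Y ^ 2 / s * Q ≤ 96 * U * J / s := by
      rw [div_mul_eq_mul_div]; exact div_le_div_of_nonneg_right hA3 hs0.le
    calc 2 * Y * Q ≤ (Y ^ 2 / s + s) * Q := e2
      _ ≤ 96 * U * J / s + J / s := by rw [add_mul]; exact add_le_add e4 e3
      _ = _ := by ring
  have key4 : X ^ 2 * |P - Q| ≤ (96 * C * U * J + (96 * U * J + J)) * (Z / s) := by
    have e1 : X ^ 2 * |P - Q| = |(X ^ 2 * P - Y ^ 2 * Q) + (Y ^ 2 - X ^ 2) * Q| := by
      rw [← abs_of_nonneg (sq_nonneg X), ← abs_mul, abs_of_nonneg (sq_nonneg X)]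
      congr 1; ring
    have e2 : |(Y ^ 2 - X ^ 2) * Q| ≤ Z * (2 * Y * Q) := by
      have h0 : 0 ≤ Y ^ 2 - X ^ 2 := by nlinarith
      rw [abs_of_nonneg (mul_nonneg h0 hP), ← mul_assoc]
      refine mul_le_mul_of_nonneg_right ?_ hP
      nlinarith
    have e3 := mul_le_mul_of_nonneg_left key3 hZ
    have e4 : Z * ((96 * U * J + J) * (1 / s)) = (96 * U * J + J) * (Z / s) := by ring
    rw [e1, add_mul]
    exact (abs_add_le _ _).trans (add_le_add key2 (e2.trans (e3.trans_eq e4)))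
  have hpos : 0 < (1 + X) ^ 2 + n := by positivity
  have key5 : ((1 + X) ^ 2 + n) * |P - Q|
      ≤ 3 * (n * |P - Q|) + 2 * (X ^ 2 * |P - Q|) := by
    -- From `(1 + X)² ≤ 2 + 2X²` and `n ≥ 1`; this is the origin of the coefficients 3 and 2.
    have : (1 + X) ^ 2 + n ≤ 3 * n + 2 * X ^ 2 := by nlinarith [sq_nonneg (1 - X)]
    nlinarith [mul_le_mul_of_nonneg_right this (abs_nonneg (P - Q))]
  rw [mul_one_div, le_div_iff₀ (by positivity)]
  have key6 := mul_le_mul_of_nonneg_right (key5.trans (add_le_add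
    (mul_le_mul_of_nonneg_left key1 (by norm_num : (0 : ℝ) ≤ 3))
    (mul_le_mul_of_nonneg_left key4 (by norm_num : (0 : ℝ) ≤ 2)))) hs0.le
  have e7 : Z / s * s = Z := div_mul_cancel₀ Z hs0.ne'
  calc |P - Q| * (s * ((1 + X) ^ 2 + n)) = ((1 + X) ^ 2 + n) * |P - Q| * s := by ring
    _ ≤ _ := key6
    _ = (3 * (32 * C * J) + 2 * (96 * C * U * J + (96 * U * J + J))) * (Z / s * s) := by
      ring
    _ = _ := by rw [e7]

/-- The bound on the gradient of the transition probabilities at a single time. -/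
theorem exists_abs_transProb_sub_le {p : PMF (ℤ × ℤ)} (hirr : IsIrreducible p)
    (hmean : HasZeroMean p) (hvar : HasFiniteVariance p) :
    ∃ K : ℝ, 0 < K ∧ ∀ x z : ℤ × ℤ, z ∈ controlled p → enorm2 x ≤ enorm2 (x + z) →
      ∀ n : ℕ, 0 < n → |transProb p n x - transProb p n (x + z)|
        ≤ K * enorm2 z * (1 / (Real.sqrt n * ((1 + enorm2 x) ^ 2 + n))) := by
  obtain ⟨J, hJ0, hJ⟩ := exists_integral_exp_defect_le hirr
  obtain ⟨C, hC, hctl⟩ := exists_uniform_control hirr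
  have m1 : HasSum (fun x : ℤ × ℤ => (AddMonoidHom.fst ℤ ℤ x : ℝ) * (p x).toReal) 0 := by
    simpa [mul_comm] using hmean.1
  have m2 : HasSum (fun x : ℤ × ℤ => (AddMonoidHom.snd ℤ ℤ x : ℝ) * (p x).toReal) 0 := by
    simpa [mul_comm] using hmean.2
  obtain ⟨V, v1⟩ : Summable fun x : ℤ × ℤ => (AddMonoidHom.fst ℤ ℤ x : ℝ) ^ 2 * (p x).toReal := by
    refine Summable.of_nonneg_of_le (fun x => by positivity) (fun x => ?_) hvar
    rw [sq_enorm2, mul_comm]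
    exact mul_le_mul_of_nonneg_left (by simp [sq_nonneg]) ENNReal.toReal_nonneg
  obtain ⟨W, v2⟩ : Summable fun x : ℤ × ℤ => (AddMonoidHom.snd ℤ ℤ x : ℝ) ^ 2 * (p x).toReal := by
    refine Summable.of_nonneg_of_le (fun x => by positivity) (fun x => ?_) hvar
    rw [sq_enorm2, mul_comm]
    exact mul_le_mul_of_nonneg_left (by simp [sq_nonneg]) ENNReal.toReal_nonneg
  have hV : 0 ≤ V := v1.nonneg fun _ => by positivity
  have hW : 0 ≤ W := v2.nonneg fun _ => by positivity
  refine ⟨3 * (32 * C * J) + 2 * (96 * C * (V + W) * J + (96 * (V + W) * J + J)),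
    by positivity, fun x z hz hxz n hn => ?_⟩
  have hzC : 0 ≤ C * enorm2 z := mul_nonneg hC (enorm2_nonneg z)
  have hB := abs_transProb_sub_le (hJ n hn) hn hzC (hctl z hz) x
  have hC1 := abs_coord_sq_mul_transProb_sub_le (hJ n hn) m1 v1 hzC (hctl z hz) x
  have hC2 := abs_coord_sq_mul_transProb_sub_le (hJ n hn) m2 v2 hzC (hctl z hz) x
  have hA := transProb_le (hJ n hn) (x + z)
  have hA1 := coord_sq_mul_transProb_le (hJ n hn) hn m1 v1 (x + z)
  have hA2 := coord_sq_mul_transProb_le (hJ n hn) hn m2 v2 (x + z)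
  simp only [AddMonoidHom.coe_fst, AddMonoidHom.coe_snd] at hC1 hC2 hA1 hA2
  have hn1 : (1 : ℝ) ≤ n := by exact_mod_cast hn
  refine abs_sub_le_of_gradient_bounds hn1 (Real.sqrt_pos.2 (by linarith))
    (Real.sq_sqrt (by linarith)).symm (enorm2_nonneg x) hxz (enorm2_add_le x z) (enorm2_nonneg z)
    (transProb_nonneg p n (x + z)) hA ?_ hB ?_
  · rw [sq_enorm2]; linarith
  · have e : enorm2 x ^ 2 * transProb p n x - enorm2 (x + z) ^ 2 * transProb p n (x + z)
        = ((x.1 : ℝ) ^ 2 * transProb p n x - ((x + z).1 : ℝ) ^ 2 * transProb p n (x + z))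
        + ((x.2 : ℝ) ^ 2 * transProb p n x - ((x + z).2 : ℝ) ^ 2 * transProb p n (x + z)) := by
      rw [sq_enorm2, sq_enorm2]; ring
    rw [e]
    refine (abs_add_le _ _).trans ((add_le_add hC1 hC2).trans_eq ?_)
    ring

/-! ### Summation over time. -/

/-- A telescoping bound for the sum over times. -/
theorem sum_one_div_sqrt_mul_le {R : ℝ} (hR : 0 < R) (N : ℕ) :
    ∑ k ∈ Finset.range N, 1 / (Real.sqrt (k + 1 : ℕ) * (R ^ 2 + (k + 1 : ℕ)))
      ≤ 4 * (1 / R - 1 / (R + Real.sqrt N)) := by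
  induction N with
  | zero => simp
  | succ N ih =>
    rw [Finset.sum_range_succ]
    set a := Real.sqrt N with ha
    set b := Real.sqrt (N + 1 : ℕ) with hb
    have ha0 : 0 ≤ a := Real.sqrt_nonneg _
    have hb0 : 0 < b := Real.sqrt_pos.2 (by positivity)
    have ha2 : a ^ 2 = N := Real.sq_sqrt (by positivity)
    have hb2 : b ^ 2 = (N + 1 : ℕ) := Real.sq_sqrt (by positivity)
    have hab : a ≤ b := Real.sqrt_le_sqrt (by push_cast; linarith)
    have hba : (b - a) * (b + a) = 1 := by
      have : b ^ 2 - a ^ 2 = 1 := by rw [ha2, hb2]; push_cast; ring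
      linarith
    have hstep : 1 / (b * (R ^ 2 + (N + 1 : ℕ))) ≤ 4 * (1 / (R + a) - 1 / (R + b)) := by
      rw [← hb2]
      have e : 1 / (R + a) - 1 / (R + b) = (b - a) / ((R + a) * (R + b)) := by
        field_simp; ring
      -- Since `b - a = 1/(a + b)` and `a ≤ b`. Together with `(R + a)(R + b) ≤ 2(R² + b²)` this
      -- loses a factor 4.
      have e1 : 1 / (2 * b) ≤ b - a := by
        rw [div_le_iff₀ (by positivity)]
        nlinarith [sub_nonneg.2 hab]
      have e2 : (R + a) * (R + b) ≤ 2 * (R ^ 2 + b ^ 2) := by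
        nlinarith [sq_nonneg (R - b)]
      rw [e]
      have e3 : 1 / (2 * b) / (2 * (R ^ 2 + b ^ 2)) ≤ (b - a) / ((R + a) * (R + b)) :=
        div_le_div₀ (sub_nonneg.2 hab) e1 (by positivity) e2
      have e4 : 1 / (b * (R ^ 2 + b ^ 2)) = 4 * (1 / (2 * b) / (2 * (R ^ 2 + b ^ 2))) := by
        field_simp; norm_num
      rw [e4]
      linarith
    linarith

theorem hasSum_le_of_le_one_div_sqrt {d : ℕ → ℝ} (hd : ∀ n, 0 ≤ d n) {A R : ℝ} (hA : 0 ≤ A)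
    (hR : 0 < R) (h : ∀ n : ℕ, 0 < n → d n ≤ A * (1 / (Real.sqrt n * (R ^ 2 + n)))) :
    Summable d ∧ ∑' n, d n ≤ d 0 + A * (4 / R) := by
  have hfin : ∀ N, ∑ k ∈ Finset.range N, d (k + 1) ≤ A * (4 / R) := by
    intro N
    refine (Finset.sum_le_sum fun k _ => h (k + 1) k.succ_pos).trans ?_
    rw [← Finset.mul_sum]
    refine mul_le_mul_of_nonneg_left ((sum_one_div_sqrt_mul_le hR N).trans ?_) hA
    have : 0 ≤ 1 / (R + Real.sqrt N) := by positivity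
    rw [show 4 / R = 4 * (1 / R) by ring]
    linarith
  have hs : Summable fun k => d (k + 1) := summable_of_sum_range_le (fun k => hd _) hfin
  have hs' : Summable d := (summable_nat_add_iff 1).1 hs
  refine ⟨hs', ?_⟩
  rw [hs'.tsum_eq_zero_add]
  exact add_le_add_right (Real.tsum_le_of_sum_range_le (fun k => hd _) hfin) _

/-- The discrete time bound for displacements controlled by the characteristic function. -/
theorem exists_tsum_abs_transProb_sub_le {p : PMF (ℤ × ℤ)} (hirr : IsIrreducible p)
    (hmean : HasZeroMean p) (hvar : HasFiniteVariance p) :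
    ∃ C : ℝ, 0 < C ∧ ∀ x z : ℤ × ℤ, z ∈ controlled p →
      Summable (fun n : ℕ => |transProb p n x - transProb p n (x + z)|) ∧
      ∑' n : ℕ, |transProb p n x - transProb p n (x + z)| ≤
        C * enorm2 z * (1 / (1 + enorm2 x) + 1 / (1 + enorm2 (x + z))) := by
  obtain ⟨K, hK, h⟩ := exists_abs_transProb_sub_le hirr hmean hvar
  have main : ∀ x z : ℤ × ℤ, z ∈ controlled p → enorm2 x ≤ enorm2 (x + z) →
      Summable (fun n : ℕ => |transProb p n x - transProb p n (x + z)|) ∧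
      ∑' n : ℕ, |transProb p n x - transProb p n (x + z)| ≤
        (4 * K + 1) * enorm2 z * (1 / (1 + enorm2 x)) := by
    intro x z hz hxz
    have hx0 := enorm2_nonneg x
    obtain ⟨h1, h2⟩ := hasSum_le_of_le_one_div_sqrt
      (d := fun n => |transProb p n x - transProb p n (x + z)|) (fun n => abs_nonneg _)
      (mul_nonneg hK.le (enorm2_nonneg z)) (by positivity : 0 < 1 + enorm2 x) (h x z hz hxz)
    refine ⟨h1, h2.trans ?_⟩
    -- The gradient bound starts at `n = 1`. At time 0 the difference can be nonzero only when `x =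
    -- 0`, because `x + z = 0` with `‖x‖ ≤ ‖x + z‖` forces `x = 0`; then `z ≠ 0` gives `1 ≤ ‖z‖`.
    have h0 : |transProb p 0 x - transProb p 0 (x + z)| ≤ enorm2 z * (1 / (1 + enorm2 x)) := by
      have hz0 := enorm2_nonneg z
      rcases eq_or_ne z 0 with rfl | hzne
      · simpa using by positivity
      have hz1 := one_le_enorm2 hzne
      rcases eq_or_ne x 0 with rfl | hx
      · simp only [transProb_zero, zero_add, hzne, if_true, if_false]
        simpa [enorm2] using hz1
      · have hxz0 : x + z ≠ 0 := by
          intro h0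
          have := one_le_enorm2 hx
          rw [h0] at hxz
          have e : enorm2 0 = 0 := by simp [enorm2]
          linarith
        simp only [transProb_zero, hx, hxz0, if_false, sub_self, abs_zero]
        positivity
    have e : K * enorm2 z * (4 / (1 + enorm2 x)) + enorm2 z * (1 / (1 + enorm2 x))
        = (4 * K + 1) * enorm2 z * (1 / (1 + enorm2 x)) := by ring
    linarith
  refine ⟨4 * K + 1, by positivity, fun x z hz => ?_⟩
  have hA : 0 ≤ (4 * K + 1) * enorm2 z := mul_nonneg (by positivity) (enorm2_nonneg z)
  have i1 : 0 ≤ 1 / (1 + enorm2 x) := by have := enorm2_nonneg x; positivity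
  have i2 : 0 ≤ 1 / (1 + enorm2 (x + z)) := by have := enorm2_nonneg (x + z); positivity
  rcases le_total (enorm2 x) (enorm2 (x + z)) with hxz | hxz
  · obtain ⟨h1, h2⟩ := main x z hz hxz
    exact ⟨h1, h2.trans (mul_le_mul_of_nonneg_left (by linarith) hA)⟩
  -- When `x + z` is the point nearer to the origin, the roles are exchanged by starting there and
  -- moving by `-z`.
  · have hb : x + z + -z = x := by abel
    obtain ⟨h1, h2⟩ := main (x + z) (-z) ((controlled p).neg_mem hz) (by rwa [hb])
    simp only [hb, enorm2_neg, abs_sub_comm (transProb p _ (x + z))] at h1 h2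
    exact ⟨h1, h2.trans (mul_le_mul_of_nonneg_left (by linarith) hA)⟩

theorem eq_of_fourierTr_eq {a b : ℤ × ℤ → ℂ} (ha : Summable a) (hb : Summable b)
    (h : ∀ θ, fourierTr a θ = fourierTr b θ) : a = b := by
  ext x
  rw [← fourierTr_inversion ha x, ← fourierTr_inversion hb x]
  simp only [h]

/-! ### The lazy walk. -/

/-- The increment law of the lazy walk, which stays put with probability `1 / 2` at each step. -/
def lazy (p : PMF (ℤ × ℤ)) : PMF (ℤ × ℤ) :=
  ⟨fun w => 2⁻¹ * (if w = 0 then 1 else 0) + 2⁻¹ * p w, by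
    have h : ∑' w, (2⁻¹ * (if w = 0 then 1 else 0) + 2⁻¹ * p w : ENNReal) = 1 := by
      rw [ENNReal.tsum_add, ENNReal.tsum_mul_left, ENNReal.tsum_mul_left, tsum_ite_eq, p.tsum_coe,
        mul_one, ENNReal.inv_two_add_inv_two]
    have hs := (ENNReal.summable
      (f := fun w => (2⁻¹ * (if w = 0 then 1 else 0) + 2⁻¹ * p w : ENNReal))).hasSum
    rwa [h] at hs⟩

section Lazy

variable {p : PMF (ℤ × ℤ)}

theorem lazy_toReal (w : ℤ × ℤ) :
    (lazy p w).toReal = 2⁻¹ * (if w = 0 then 1 else 0) + 2⁻¹ * (p w).toReal := by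
  change (2⁻¹ * (if w = 0 then 1 else 0) + 2⁻¹ * p w : ENNReal).toReal = _
  rw [ENNReal.toReal_add, ENNReal.toReal_mul, ENNReal.toReal_mul]
  · split_ifs <;> simp
  · split_ifs <;> simp
  · exact ENNReal.mul_ne_top (by simp) (p.apply_ne_top w)

theorem fourierTr_inc_lazy (θ : ℝ × ℝ) :
    fourierTr (inc (lazy p)) θ = (1 + fourierTr (inc p) θ) / 2 := by
  have h0 : HasSum (fun w => (if w = 0 then 1 else 0 : ℂ) * chr θ w) 1 := by
    have := hasSum_ite_eq (0 : ℤ × ℤ) (1 : ℂ)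
    refine (this.congr_fun fun w => ?_)
    split_ifs with h <;> simp [h, chr_zero]
  have h1 := (h0.mul_left 2⁻¹).add ((summable_mul_chr (summable_inc p) θ).hasSum.mul_left 2⁻¹)
  have h2 : (fun w => inc (lazy p) w * chr θ w) = fun w =>
      2⁻¹ * ((if w = 0 then 1 else 0 : ℂ) * chr θ w) + 2⁻¹ * (inc p w * chr θ w) := by
    ext w
    rw [inc, lazy_toReal, inc]
    split_ifs <;> push_cast <;> ring
  rw [fourierTr, h2, h1.tsum_eq, fourierTr]
  ring

theorem hasSum_lazy_mul {f : ℤ × ℤ → ℝ} (h : HasSum (fun w => (p w).toReal * f w) 0)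
    (h0 : f 0 = 0) : HasSum (fun w => (lazy p w).toReal * f w) 0 := by
  have e : (fun w => (lazy p w).toReal * f w) = fun w => 2⁻¹ * ((p w).toReal * f w) := by
    ext w
    rw [lazy_toReal]
    split_ifs with hw
    · simp [hw, h0]
    · ring
  have := h.mul_left 2⁻¹
  rw [mul_zero] at this
  rwa [e]

theorem HasZeroMean.lazy (h : HasZeroMean p) : HasZeroMean (lazy p) :=
  ⟨hasSum_lazy_mul h.1 (by simp), hasSum_lazy_mul h.2 (by simp)⟩

theorem HasFiniteVariance.lazy (h : HasFiniteVariance p) : HasFiniteVariance (lazy p) := by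
  refine (Summable.mul_left 2⁻¹ h).congr fun w => ?_
  rw [lazy_toReal]
  split_ifs with hw
  · simp [hw, enorm2]
  · ring

/-- With probability `2⁻ⁿ` none of the first `n` steps is a forced rest. -/
theorem mul_transProb_le_lazy (n : ℕ) (x : ℤ × ℤ) :
    2⁻¹ ^ n * transProb p n x ≤ transProb (lazy p) n x := by
  have hs : ∀ (q r : PMF (ℤ × ℤ)) (n : ℕ) (x : ℤ × ℤ),
      Summable fun y => transProb q n y * (r (x - y)).toReal := fun q r n x => by
    refine Summable.of_nonneg_of_le (fun y => mul_nonneg (transProb_nonneg q n y)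
      ENNReal.toReal_nonneg) (fun y => mul_le_of_le_one_right (transProb_nonneg q n y) ?_)
      (hasSum_transProb q n).summable
    exact ENNReal.toReal_le_of_le_ofReal zero_le_one (by simpa using r.coe_le_one _)
  induction n generalizing x with
  | zero => simp [transProb_zero]
  | succ n ih =>
    rw [transProb_succ, transProb_succ, ← tsum_mul_left]
    refine ((hs p p n x).mul_left _).tsum_le_tsum (fun y => ?_) (hs _ _ n x)
    have h1 : 2⁻¹ * (p (x - y)).toReal ≤ (PlanarWalk.lazy p (x - y)).toReal := by
      rw [lazy_toReal]
      split_ifs <;> simp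
    have := mul_le_mul (ih y) h1 (by positivity) (transProb_nonneg _ _ _)
    refine le_trans (le_of_eq ?_) this
    ring

theorem IsIrreducible.lazy (h : IsIrreducible p) : IsIrreducible (lazy p) := by
  intro x
  obtain ⟨n, hn⟩ := h x
  exact ⟨n, lt_of_lt_of_le (by positivity) (mul_transProb_le_lazy n x)⟩

/-- Resting has positive probability, so `χ(0) = 1` is itself within a multiple of `g` of `φ`; hence
`1 ≈ φⁿ ≈ χ(z)`. -/
theorem mem_controlled_lazy (h : IsIrreducible p) (z : ℤ × ℤ) : z ∈ controlled (lazy p) := by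
  obtain ⟨n, hn⟩ := h.lazy z
  obtain ⟨C, hC, h1⟩ := exists_norm_chr_sub_pow_le hn
  have h0 : 0 < (PlanarWalk.lazy p 0).toReal := by
    rw [lazy_toReal, if_pos rfl]
    have := ENNReal.toReal_nonneg (a := p 0)
    linarith
  refine ⟨n * (1 / Real.sqrt (PlanarWalk.lazy p 0).toReal) + C, by positivity, fun θ => ?_⟩
  have h2 := norm_chr_sub_le (PlanarWalk.lazy p) θ h0
  rw [chr_zero] at h2
  have h3 := norm_pow_sub_pow_le (a := 1) (by simp)
    (norm_fourierTr_inc_le_one (PlanarWalk.lazy p) θ) n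
  rw [one_pow] at h3
  have h4 := mul_le_mul_of_nonneg_left h2 (Nat.cast_nonneg (α := ℝ) n)
  refine (norm_sub_le_norm_sub_add_norm_sub _ (fourierTr (inc (PlanarWalk.lazy p)) θ ^ n) _).trans ?_
  rw [norm_sub_rev _ (chr θ z), add_mul, mul_assoc]
  exact add_le_add (h3.trans h4) (h1 θ)

end Lazy

/-! ### Continuous time by Poisson mixing. -/

/-- The Poisson weight of `n` jumps for the mean `s`. -/
def poissonWeight (s : ℝ) (n : ℕ) : ℝ := Real.exp (-s) * s ^ n / n.factorial

theorem poissonWeight_nonneg {s : ℝ} (hs : 0 ≤ s) (n : ℕ) : 0 ≤ poissonWeight s n := by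
  unfold poissonWeight; positivity

theorem summable_poissonWeight (s : ℝ) : Summable (poissonWeight s) := by
  have := (Real.summable_pow_div_factorial s).mul_left (Real.exp (-s))
  exact this.congr fun n => by rw [poissonWeight, mul_div_assoc]

theorem summable_poissonWeight_mul (p : PMF (ℤ × ℤ)) (s : ℝ) (x : ℤ × ℤ) :
    Summable fun n => poissonWeight s n * transProb p n x := by
  refine Summable.of_norm_bounded (summable_poissonWeight s).norm fun n => ?_
  rw [norm_mul, Real.norm_of_nonneg (transProb_nonneg p n x)]
  refine mul_le_of_le_one_right (norm_nonneg _) ?_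
  exact le_hasSum (hasSum_transProb p n) x fun y _ => transProb_nonneg p n y

theorem transProbCont_eq (p : PMF (ℤ × ℤ)) (κ t : ℝ) (x : ℤ × ℤ) :
    transProbCont p κ t x = ∑' n, poissonWeight (κ * t) n * transProb p n x := rfl

theorem summable_poissonWeight_mul_law (p : PMF (ℤ × ℤ)) {s : ℝ} (hs : 0 ≤ s) :
    Summable fun q : ℕ × (ℤ × ℤ) => (poissonWeight s q.1 : ℂ) * law p q.1 q.2 := by
  have h : Summable fun q : ℕ × (ℤ × ℤ) => poissonWeight s q.1 * transProb p q.1 q.2 := by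
    have h0 : 0 ≤ fun q : ℕ × (ℤ × ℤ) => poissonWeight s q.1 * transProb p q.1 q.2 := fun q =>
      mul_nonneg (poissonWeight_nonneg hs q.1) (transProb_nonneg p q.1 q.2)
    refine (summable_prod_of_nonneg h0).2 ⟨fun n => ?_, ?_⟩
    · exact (hasSum_transProb p n).summable.mul_left (poissonWeight s n)
    · refine (summable_poissonWeight s).congr fun n => ?_
      dsimp only
      rw [tsum_mul_left, (hasSum_transProb p n).tsum_eq, mul_one]
  exact (Complex.summable_ofReal.2 h).congr fun q => by rw [law, Complex.ofReal_mul]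

theorem ofReal_transProbCont (p : PMF (ℤ × ℤ)) (κ t : ℝ) (x : ℤ × ℤ) :
    (transProbCont p κ t x : ℂ) = ∑' n, (poissonWeight (κ * t) n : ℂ) * law p n x := by
  rw [transProbCont_eq, Complex.ofReal_tsum]
  simp [law]

theorem summable_transProbCont (p : PMF (ℤ × ℤ)) {κ t : ℝ} (hs : 0 ≤ κ * t) :
    Summable fun x => (transProbCont p κ t x : ℂ) := by
  simp only [ofReal_transProbCont]
  exact ((Equiv.prodComm _ _).summable_iff.2 (summable_poissonWeight_mul_law p hs)).prod

theorem fourierTr_transProbCont (p : PMF (ℤ × ℤ)) {κ t : ℝ} (hs : 0 ≤ κ * t) (θ : ℝ × ℝ) :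
    fourierTr (fun x => (transProbCont p κ t x : ℂ)) θ
      = Complex.exp ((κ * t : ℝ) * (fourierTr (inc p) θ - 1)) := by
  set s := κ * t
  have hsum := summable_poissonWeight_mul_law p hs
  have hsum' : Summable fun q : ℕ × (ℤ × ℤ) =>
      (poissonWeight s q.1 : ℂ) * law p q.1 q.2 * chr θ q.2 :=
    Summable.of_norm (by simpa [norm_chr] using hsum.norm)
  have h1 : fourierTr (fun x => (transProbCont p κ t x : ℂ)) θ
      = ∑' x, ∑' n, (poissonWeight s n : ℂ) * law p n x * chr θ x := by
    simp only [fourierTr, ofReal_transProbCont, ← tsum_mul_right, s]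
  have h2 : ∀ n, ∑' x, (poissonWeight s n : ℂ) * law p n x * chr θ x
      = poissonWeight s n * fourierTr (inc p) θ ^ n := by
    intro n
    rw [← fourierTr_law, fourierTr, ← tsum_mul_left]
    simp only [mul_assoc]
  rw [h1, hsum'.tsum_comm]
  simp only [h2]
  have h3 := (NormedSpace.expSeries_div_hasSum_exp ((s : ℂ) * fourierTr (inc p) θ)).mul_left
    (Complex.exp (-s))
  rw [← Complex.exp_eq_exp_ℂ, ← Complex.exp_add] at h3
  rw [mul_sub, mul_one, sub_eq_neg_add, ← h3.tsum_eq]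
  refine tsum_congr fun n => ?_
  rw [poissonWeight]
  push_cast
  ring

/-- The two transforms agree: `2κ ((1 + φ)/2 - 1) = κ (φ - 1)`. -/
theorem transProbCont_lazy (p : PMF (ℤ × ℤ)) {κ t : ℝ} (hs : 0 ≤ κ * t) (x : ℤ × ℤ) :
    transProbCont (lazy p) (2 * κ) t x = transProbCont p κ t x := by
  have hs' : 0 ≤ 2 * κ * t := by linarith
  have h := eq_of_fourierTr_eq (summable_transProbCont (lazy p) hs') (summable_transProbCont p hs)
    fun θ => by
      rw [fourierTr_transProbCont _ hs', fourierTr_transProbCont _ hs, fourierTr_inc_lazy]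
      congr 1
      push_cast
      ring
  exact_mod_cast congrFun h x

theorem integral_poissonWeight {κ : ℝ} (hκ : 0 < κ) (n : ℕ) :
    ∫ t in Set.Ioi (0 : ℝ), poissonWeight (κ * t) n = 1 / κ := by
  have h := Real.integral_rpow_mul_exp_neg_mul_Ioi (a := n + 1) (r := κ) (by positivity) hκ
  have hf : (n.factorial : ℝ) ≠ 0 := by positivity
  have e : ∀ t : ℝ, poissonWeight (κ * t) n
      = κ ^ n / n.factorial * (t ^ ((n : ℝ) + 1 - 1) * Real.exp (-(κ * t))) := by
    intro t
    rw [poissonWeight, add_sub_cancel_right, Real.rpow_natCast, mul_pow]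
    ring
  simp only [e]
  rw [integral_const_mul, h, Real.Gamma_nat_eq_factorial, Real.rpow_add_one (by positivity),
    Real.rpow_natCast, one_div, inv_pow]
  field_simp

theorem integrableOn_poissonWeight {κ : ℝ} (hκ : 0 < κ) (n : ℕ) :
    IntegrableOn (fun t => poissonWeight (κ * t) n) (Set.Ioi 0) := by
  -- A non-integrable function has integral 0 by convention, which contradicts the value `1/κ`.
  by_contra h
  have := integral_undef h
  rw [integral_poissonWeight hκ n] at this
  exact (one_div_pos.2 hκ).ne' this

theorem measurable_transProbCont (p : PMF (ℤ × ℤ)) (κ : ℝ) (x : ℤ × ℤ) :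
    Measurable fun t => transProbCont p κ t x := by
  refine measurable_of_tendsto_metrizable (f := fun N t =>
    ∑ n ∈ Finset.range N, poissonWeight (κ * t) n * transProb p n x) (fun N => ?_) ?_
  · unfold poissonWeight; fun_prop
  · rw [tendsto_pi_nhds]
    exact fun t => (summable_poissonWeight_mul p (κ * t) x).hasSum.tendsto_sum_nat

/-- The continuous time integral is dominated by the sum over the jump chain. -/
theorem integral_abs_transProbCont_sub_le (p : PMF (ℤ × ℤ)) {κ : ℝ} (hκ : 0 < κ) (x y : ℤ × ℤ)
    (h : Summable fun n => |transProb p n x - transProb p n y|) :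
    IntegrableOn (fun t => |transProbCont p κ t x - transProbCont p κ t y|) (Set.Ioi 0) ∧
      ∫ t in Set.Ioi (0 : ℝ), |transProbCont p κ t x - transProbCont p κ t y|
        ≤ 1 / κ * ∑' n, |transProb p n x - transProb p n y| := by
  set d : ℕ → ℝ := fun n => |transProb p n x - transProb p n y| with hd
  have hd0 : ∀ n, 0 ≤ d n := fun n => abs_nonneg _
  have hT : 0 ≤ ∑' n, d n := tsum_nonneg hd0
  have hmeas : Measurable fun t => |transProbCont p κ t x - transProbCont p κ t y| :=
    ((measurable_transProbCont p κ x).sub (measurable_transProbCont p κ y)).abs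
  have hpt : ∀ t ∈ Set.Ioi (0 : ℝ),
      ENNReal.ofReal |transProbCont p κ t x - transProbCont p κ t y|
        ≤ ∑' n, ENNReal.ofReal (poissonWeight (κ * t) n * d n) := by
    intro t ht
    have hs : 0 ≤ κ * t := mul_nonneg hκ.le (le_of_lt ht)
    have hsx := summable_poissonWeight_mul p (κ * t) x
    have hsy := summable_poissonWeight_mul p (κ * t) y
    have hn : ∀ n, ‖poissonWeight (κ * t) n * transProb p n x
        - poissonWeight (κ * t) n * transProb p n y‖ = poissonWeight (κ * t) n * d n := by
      intro n
      rw [← mul_sub, norm_mul, Real.norm_of_nonneg (poissonWeight_nonneg hs n), Real.norm_eq_abs]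
    have hsd : Summable fun n => poissonWeight (κ * t) n * d n :=
      (hsx.sub hsy).norm.congr hn
    rw [← ENNReal.ofReal_tsum_of_nonneg
      (fun n => mul_nonneg (poissonWeight_nonneg hs n) (hd0 n)) hsd]
    refine ENNReal.ofReal_le_ofReal ?_
    rw [transProbCont_eq, transProbCont_eq, ← hsx.tsum_sub hsy, ← tsum_congr hn,
      ← Real.norm_eq_abs]
    exact norm_tsum_le_tsum_norm (hsx.sub hsy).norm
  -- Tonelli in `[0, ∞]` exchanges sum and integral without prior integrability, and gives both
  -- integrability and the bound.
  have hlin : ∫⁻ t in Set.Ioi (0 : ℝ),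
      ENNReal.ofReal |transProbCont p κ t x - transProbCont p κ t y|
        ≤ ENNReal.ofReal (1 / κ * ∑' n, d n) := by
    refine (setLIntegral_mono' measurableSet_Ioi hpt).trans ?_
    rw [lintegral_tsum]
    · rw [← tsum_mul_left, ENNReal.ofReal_tsum_of_nonneg
        (fun n => mul_nonneg (by positivity) (hd0 n)) (h.mul_left _)]
      refine ENNReal.tsum_le_tsum fun n => le_of_eq ?_
      rw [← integral_poissonWeight hκ n, ← integral_mul_const,
        ofReal_integral_eq_lintegral_ofReal ((integrableOn_poissonWeight hκ n).mul_const _)]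
      exact (ae_restrict_mem measurableSet_Ioi).mono fun t ht =>
        mul_nonneg (poissonWeight_nonneg (mul_nonneg hκ.le (le_of_lt ht)) n) (hd0 n)
    · intro n
      unfold poissonWeight
      fun_prop
  refine ⟨⟨hmeas.aestronglyMeasurable, ?_⟩, ?_⟩
  · rw [hasFiniteIntegral_iff_ofReal (ae_of_all _ fun t => abs_nonneg _)]
    exact hlin.trans_lt ENNReal.ofReal_lt_top
  · rw [integral_eq_lintegral_of_nonneg_ae (ae_of_all _ fun t => abs_nonneg _)
      hmeas.aestronglyMeasurable]
    exact ENNReal.toReal_le_of_le_ofReal (by positivity) hlin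

theorem exists_integral_abs_transProbCont_sub_le {p : PMF (ℤ × ℤ)} (hirr : IsIrreducible p)
    (hmean : HasZeroMean p) (hvar : HasFiniteVariance p) {κ : ℝ} (hκ : 0 < κ) :
    ∃ C : ℝ, 0 < C ∧ ∀ x z : ℤ × ℤ,
      IntegrableOn (fun t => |transProbCont p κ t x - transProbCont p κ t (x + z)|) (Set.Ioi 0) ∧
      ∫ t in Set.Ioi (0 : ℝ), |transProbCont p κ t x - transProbCont p κ t (x + z)| ≤
        C * enorm2 z * (1 / (1 + enorm2 x) + 1 / (1 + enorm2 (x + z))) := by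
  obtain ⟨C, hC, h⟩ := exists_tsum_abs_transProb_sub_le hirr.lazy hmean.lazy hvar.lazy
  have h2κ : 0 < 2 * κ := by positivity
  refine ⟨1 / (2 * κ) * C, by positivity, fun x z => ?_⟩
  obtain ⟨hs, hle⟩ := h x z (mem_controlled_lazy hirr z)
  obtain ⟨h1, h2⟩ := integral_abs_transProbCont_sub_le (lazy p) h2κ x (x + z) hs
  have e : Set.EqOn (fun t => |transProbCont (lazy p) (2 * κ) t x
      - transProbCont (lazy p) (2 * κ) t (x + z)|)
      (fun t => |transProbCont p κ t x - transProbCont p κ t (x + z)|) (Set.Ioi 0) := by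
    intro t ht
    have hs : 0 ≤ κ * t := mul_nonneg hκ.le (le_of_lt ht)
    simp only [transProbCont_lazy p hs]
  refine ⟨h1.congr_fun e measurableSet_Ioi, ?_⟩
  rw [← setIntegral_congr_fun measurableSet_Ioi e]
  refine h2.trans ((mul_le_mul_of_nonneg_left hle (by positivity)).trans_eq ?_)
  ring

end PlanarWalk
end

theorem lemmaL (p : PMF (ℤ × ℤ)) (hirr : PlanarWalk.IsIrreducible p)
    (hmean : PlanarWalk.HasZeroMean p) (hvar : PlanarWalk.HasFiniteVariance p) :
    (∃ C : ℝ, 0 < C ∧ ∀ x z₀ : ℤ × ℤ,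
      (∃ n : ℕ, 0 < PlanarWalk.transProb p n x * PlanarWalk.transProb p n (x + z₀)) →
      Summable (fun n : ℕ =>
        |PlanarWalk.transProb p n x - PlanarWalk.transProb p n (x + z₀)|) ∧
      ∑' n : ℕ, |PlanarWalk.transProb p n x - PlanarWalk.transProb p n (x + z₀)| ≤
        C * PlanarWalk.enorm2 z₀ *
          (1 / (1 + PlanarWalk.enorm2 x) + 1 / (1 + PlanarWalk.enorm2 (x + z₀)))) ∧
    (∀ κ : ℝ, 0 < κ → ∃ C : ℝ, 0 < C ∧ ∀ x z₀ : ℤ × ℤ,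
      MeasureTheory.IntegrableOn (fun t : ℝ =>
        |PlanarWalk.transProbCont p κ t x - PlanarWalk.transProbCont p κ t (x + z₀)|)
        (Set.Ioi 0) MeasureTheory.volume ∧
      ∫ t in Set.Ioi (0 : ℝ),
          |PlanarWalk.transProbCont p κ t x - PlanarWalk.transProbCont p κ t (x + z₀)| ≤
        C * PlanarWalk.enorm2 z₀ *
          (1 / (1 + PlanarWalk.enorm2 x) + 1 / (1 + PlanarWalk.enorm2 (x + z₀)))) := by
  refine ⟨?_, fun κ hκ =>
    PlanarWalk.exists_integral_abs_transProbCont_sub_le hirr hmean hvar hκ⟩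
  obtain ⟨C, hC, h⟩ := PlanarWalk.exists_tsum_abs_transProb_sub_le hirr hmean hvar
  exact ⟨C, hC, fun x z₀ ⟨_, hn⟩ => h x z₀ (PlanarWalk.mem_controlled_of_pos hn)⟩
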